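/- Consider the square lattice with mesh one, its unit squares $[a,a+1]\times[b,b+1]$ ($a,b\in\mathbb Z$) being coloured black if $a+b$ is even and white otherwise; a black square is of type $0$ if $a$ and $b$ are both even. Let $\Omega$ be an odd Temperley domain: a finite simply connected union of unit squares bounded by a simple closed lattice path, all of whose corner squares are black of type $0$ (the corner square of a convex corner is the only square of $\Omega$ at that corner, the corner square of a concave corner is the square of $\Omega$ opposite to the missing one). Let $u_1,u_2$ be black squares of $\Omega$ having a side on the boundary of $\Omega$, such that $\Omega_1=\Omega\setminus\{u_1\}$ and $\Omega_2=\Omega\setminus\{u_2\}$ admit domino tilings. For a domino tiling $T$ of $\Omega_i$ and a fixed vertex $z_0$ of both $\Omega_1$ and $\Omega_2$, let $h_i$ be its height function on the vertices of $\Omega_i$: $h_i(z_0)=0$, and along each oriented side of a square of $\Omega_i$ with a black square on its left, $h_i$ increases by $\frac14$ if the side does not cross a domino of $T$ and decreases by $\frac34$ if it does; with a white square on the left, it decreases by $\frac14$, respectively increases by $\frac34$. The double-dimer height function is $h=h_1-h_2$ for independent uniformly random domino tilings of $\Omega_1$ and $\Omega_2$. Put $H=\mathbb E[h]$. Then $H$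 is discrete leap-frog harmonic: for every vertex $z$ of $\Omega$ not on the boundary of $\Omega$, $$[\Delta H](z)=\frac14\sum_{e}\bigl(H(z+2e)-H(z)\bigr)=0,$$ where $e$ runs over the four unit lattice vectors, and where, if the segment from $z+e$ to $z+2e$ is not a side of a square of $\Omega$ (so that the leap leaves $\Omega$ through its boundary at $z+e$), $H(z+2e)$ is understood as the boundary value $H(z+e)$. -/

import Mathlib

open scoped BigOperators

namespace DoubleDimer

/-- A vertex of the square lattice of mesh one. -/
abbrev Vertex : Type := ℤ × ℤ

/-- A unit square of the lattice; `(a, b)` stands for `[a, a + 1] × [b, b + 1]`. -/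
abbrev Face : Type := ℤ × ℤ

/-- Two squares are adjacent if they share a side. -/
def faceGraph : SimpleGraph Face where
  Adj f g := (f.1 = g.1 ∧ (f.2 = g.2 + 1 ∨ g.2 = f.2 + 1)) ∨
    (f.2 = g.2 ∧ (f.1 = g.1 + 1 ∨ g.1 = f.1 + 1))
  symm := ⟨fun f g h => by
    rcases h with ⟨h, h1 | h1⟩ | ⟨h, h1 | h1⟩
    · exact Or.inl ⟨h.symm, Or.inr h1⟩
    · exact Or.inl ⟨h.symm, Or.inl h1⟩
    · exact Or.inr ⟨h.symm, Or.inr h1⟩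
    · exact Or.inr ⟨h.symm, Or.inl h1⟩⟩
  loopless := ⟨fun f h => by
    rcases h with ⟨_, h1 | h1⟩ | ⟨_, h1 | h1⟩ <;> omega⟩

/-- The black squares of the checkerboard; the other squares are white. -/
def IsBlack (f : Face) : Prop := Even (f.1 + f.2)

instance (f : Face) : Decidable (IsBlack f) := inferInstanceAs (Decidable (Even (f.1 + f.2)))

/-- The black squares lying in even rows (equivalently, in even columns): one of the two classes of
black squares. -/
def IsBlackZero (f : Face) : Prop := Even f.1 ∧ Even f.2

/-- The four directions of lattice edges. -/
inductive Dir : Type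
  | east | north | west | south
  deriving DecidableEq

instance : Fintype Dir where
  elems := {.east, .north, .west, .south}
  complete d := by cases d <;> simp

/-- The unit vector of a direction. -/
def Dir.vec : Dir → ℤ × ℤ
  | .east => (1, 0)
  | .north => (0, 1)
  | .west => (-1, 0)
  | .south => (0, -1)

/-- The square on the left of the edge traversed from `z` to `z + d.vec`. -/
def leftFace (z : Vertex) : Dir → Face
  | .east => (z.1, z.2)
  | .north => (z.1 - 1, z.2)
  | .west => (z.1 - 1, z.2 - 1)
  | .south => (z.1, z.2 - 1)

/-- The square on the right of the edge traversed from `z` to `z + d.vec`. -/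
def rightFace (z : Vertex) : Dir → Face
  | .east => (z.1, z.2 - 1)
  | .north => (z.1, z.2)
  | .west => (z.1 - 1, z.2)
  | .south => (z.1 - 1, z.2 - 1)

/-- The four squares that have `z` as a vertex. -/
def facesAt (z : Vertex) : Finset Face :=
  {(z.1, z.2), (z.1 - 1, z.2), (z.1 - 1, z.2 - 1), (z.1, z.2 - 1)}

/-- The vertices of the squares of `D`. -/
def IsVertexOf (D : Finset Face) (z : Vertex) : Prop := ∃ f ∈ facesAt z, f ∈ D

/-- The vertices of `D` that are not on the boundary of `D`. -/
def IsInteriorVertex (D : Finset Face) (z : Vertex) : Prop := ∀ f ∈ facesAt z, f ∈ D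

/-- The lattice edge from `z` to `z + d.vec` is a side of a square of `D`. -/
def IsEdgeOf (D : Finset Face) (z : Vertex) (d : Dir) : Prop :=
  leftFace z d ∈ D ∨ rightFace z d ∈ D

instance (D : Finset Face) (z : Vertex) (d : Dir) : Decidable (IsEdgeOf D z d) :=
  inferInstanceAs (Decidable (leftFace z d ∈ D ∨ rightFace z d ∈ D))

/-- A simply connected discrete domain: a finite nonempty set of squares, connected through sides,
whose complement is connected through sides (there are no holes), and whose boundary is a simple
curve, i.e. no vertex is surrounded by exactly two squares of `D` placed diagonally. -/
structure IsSimplyConnectedDomain (D : Finset Face) : Prop where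
  connected : (faceGraph.induce {f : Face | f ∈ D}).Connected
  compl_connected : (faceGraph.induce {f : Face | f ∉ D}).Connected
  simple_boundary : ∀ f : Face, ∀ s ∈ ({1, -1} : Set ℤ), ∀ t ∈ ({1, -1} : Set ℤ),
    f ∈ D → f + (s, t) ∈ D → f + (s, 0) ∈ D ∨ f + (0, t) ∈ D

/-- `f` is the square of `D` in a corner of `D`. At the vertex shared by `f` and `f + (s, t)`,
the corner is convex if `f` is the only square of `D` there, and concave if the square `f + (s, t)`
opposite to `f` is the only one missing. -/
def IsCornerSquare (D : Finset Face) (f : Face) : Prop :=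
  f ∈ D ∧ ∃ s ∈ ({1, -1} : Set ℤ), ∃ t ∈ ({1, -1} : Set ℤ), f + (s, t) ∉ D ∧
    ((f + (s, 0) ∉ D ∧ f + (0, t) ∉ D) ∨ (f + (s, 0) ∈ D ∧ f + (0, t) ∈ D))

/-- An odd Temperley domain: all the corner squares are black squares of the same class. -/
structure IsOddTemperley (D : Finset Face) : Prop where
  domain : IsSimplyConnectedDomain D
  corner : ∀ f : Face, IsCornerSquare D f → IsBlackZero f

/-- The black squares of `D` that have a side on the boundary of `D`. -/
def IsBoundaryBlack (D : Finset Face) (u : Face) : Prop :=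
  u ∈ D ∧ IsBlack u ∧ ∃ f : Face, faceGraph.Adj u f ∧ f ∉ D

open Classical in
/-- The domino tilings (dimer coverings) of `D`: sets of pairs of adjacent squares of `D` such that
each square of `D` lies in exactly one pair. -/
noncomputable def tilings (D : Finset Face) : Finset (Finset (Sym2 Face)) :=
  D.sym2.powerset.filter fun T =>
    (∀ e ∈ T, e ∈ faceGraph.edgeSet) ∧ ∀ f ∈ D, ∃! e : Sym2 Face, e ∈ T ∧ f ∈ e

/-- The change of the height along an edge with `l` on its left and `r` on its right. -/
noncomputable def heightStep (T : Finset (Sym2 Face)) (l r : Face) : ℝ :=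
  if s(l, r) ∈ T then (if IsBlack l then -(3 / 4) else 3 / 4)
  else (if IsBlack l then 1 / 4 else -(1 / 4))

/-- `h` is the height function of the tiling `T` of `D` with `h z₀ = 0`. Only its values at the
vertices of `D` matter. -/
structure IsHeightFunction (D : Finset Face) (T : Finset (Sym2 Face)) (z₀ : Vertex)
    (h : Vertex → ℝ) : Prop where
  base : h z₀ = 0
  step : ∀ (z : Vertex) (d : Dir), IsEdgeOf D z d →
    h (z + d.vec) - h z = heightStep T (leftFace z d) (rightFace z d)

/-- The expectation at `z` of the double-dimer height function `h₁ - h₂`, for two independent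
uniform tilings of `D₁` and `D₂`, where `hᵢ T` is the height function of the tiling `T` of `Dᵢ`. -/
noncomputable def expectedHeight (D₁ D₂ : Finset Face)
    (h₁ h₂ : Finset (Sym2 Face) → Vertex → ℝ) (z : Vertex) : ℝ :=
  𝔼 p ∈ tilings D₁ ×ˢ tilings D₂, (h₁ p.1 z - h₂ p.2 z)

/-- The value of `H` at the leap-frog neighbour `z + 2 • d.vec` of `z`. If the second half of the
leap is not an edge of `D` (the leap leaves the domain through its boundary at `z + d.vec`),
then `H` is continued outside by its boundary value at `z + d.vec`. -/
noncomputable def leapValue (D : Finset Face) (H : Vertex → ℝ) (z : Vertex) (d : Dir) : ℝ :=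
  if IsEdgeOf D (z + d.vec) d then H (z + d.vec + d.vec) else H (z + d.vec)

/-- The discrete leap-frog Laplacian, for mesh one. -/
noncomputable def leapFrogLaplacian (D : Finset Face) (H : Vertex → ℝ) (z : Vertex) : ℝ :=
  1 / 4 * ∑ d : Dir, (leapValue D H z d - H z)

end DoubleDimer

namespace DoubleDimer

/-! The mechanism is Temperley's correspondence. Black squares of class `0` are the vertices, those
of class `1` the faces and white squares the edges of a planar graph. As all corners have class `0`,
a white square of `Ω` has both its class `0` neighbours in `Ω` (`IsOddTemperley.axis_mem`) and a
class `1` square all its neighbours (`IsOddTemperley.adj_mem`); in particular the removed boundary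
squares are vertices. A tiling of `Ω` without the vertex `u` matches each edge with a face or with a
vertex other than `u`, and the edges matched with vertices form a spanning tree. Each tree comes
from exactly one matching for each of the two roots.

Hence both domains have equally many tilings. Two tilings with the same tree agree on the dominoes
covering class `1` squares, and on the others they differ by the unit flow in the tree from `u₁` to
`u₂` (`IsSpanningTree.compare`). Summed over all trees this flow is an electric current, so it has
no curl around any face (`sum_tree_flow_mul_cycle`). An increment of `H` is thus zero along a side
next to a class `1` square, and up to sign and normalization a value of the current `G` along a side
next to a class `0` square. Each leap contains one side of each kind, and the four leaps from `z`
add up to the curl of `G` around the only class `1` square at `z`.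

Trees are treated by linear algebra: a tree is a maximal independent set of rows of the incidence
matrix, and its complement supports an invertible part of the curl matrix. The absence of holes
enters through acyclicity (`IsRootedMatching.isAcyclic`): a flow on matched edges has a potential on
the squares of the other class, a nonzero level set of which is closed under the matching and so
carries a new flow strictly further west (`IsMatchedFlow.exists_inner`). The descent cannot continue
forever. -/

/-! ### Linear algebra -/

/-- A square matrix with independent rows has a nonvanishing generalized diagonal, and it acts
bijectively on column vectors. -/
theorem exists_diagonal_of_vecMul_injective {m n : Type*} [Fintype m] [Fintype n] [DecidableEq m]
    [DecidableEq n] (A : Matrix m n ℝ) (hcard : Fintype.card m = Fintype.card n)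
    (h : ∀ c : m → ℝ, (∀ j, ∑ i, c i * A i j = 0) → c = 0) :
    (∃ σ : m ≃ n, ∀ i, A i (σ i) ≠ 0) ∧ (∀ y : m → ℝ, ∃ x : n → ℝ, ∀ i, ∑ j, A i j * x j = y i) ∧
      ∀ x : n → ℝ, (∀ i, ∑ j, A i j * x j = 0) → x = 0 := by
  classical
  let e : m ≃ n := Fintype.equivOfCardEq hcard
  let B : Matrix m m ℝ := A.submatrix id e
  have hdet : B.det ≠ 0 := by
    intro h0
    obtain ⟨c, hc, hc0⟩ := Matrix.exists_vecMul_eq_zero_iff.mpr h0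
    apply hc
    apply h
    intro j
    have := congrFun hc0 (e.symm j)
    simpa [Matrix.vecMul, dotProduct, B] using this
  have hu : IsUnit B.det := isUnit_iff_ne_zero.mpr hdet
  have key : ∀ x : n → ℝ, ∀ i, ∑ j, A i j * x j = (B.mulVec (x ∘ e)) i := by
    intro x i
    simp only [Matrix.mulVec, dotProduct, B, Matrix.submatrix_apply, id, Function.comp]
    exact (Equiv.sum_comp e (fun j => A i j * x j)).symm
  refine ⟨?_, ?_, ?_⟩
  -- A nonzero determinant has a nonzero term in its Leibniz expansion.
  · rw [Matrix.det_apply] at hdet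
    obtain ⟨σ, -, hσ⟩ := Finset.exists_ne_zero_of_sum_ne_zero hdet
    refine ⟨σ⁻¹.trans e, fun i hi => hσ ?_⟩
    rw [Finset.prod_eq_zero (Finset.mem_univ (σ⁻¹ i)), smul_zero]
    simpa [B] using hi
  · intro y
    refine ⟨(B⁻¹.mulVec y) ∘ e.symm, fun i => ?_⟩
    rw [key]
    have : ((B⁻¹.mulVec y) ∘ e.symm) ∘ e = B⁻¹.mulVec y := by ext; simp
    rw [this, Matrix.mulVec_mulVec, Matrix.mul_nonsing_inv _ hu, Matrix.one_mulVec]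
  · intro x hx
    have h0 : B.mulVec (x ∘ e) = 0 := by
      ext i
      rw [← key]
      exact hx i
    have := Matrix.eq_zero_of_mulVec_eq_zero hdet h0
    ext j
    simpa using congrFun this (e.symm j)

/-- If the nonzero entries of a row are pairwise opposite, the difference of the indicators of two of
their positions is a multiple of the row. -/
theorem exists_indicator_sub_eq_mul {X : Type*} [DecidableEq X] (r : X → ℝ)
    (hr : ∀ x y, x ≠ y → r x ≠ 0 → r y ≠ 0 → r x + r y = 0) {x x' : X} (hx : r x ≠ 0)
    (hx' : r x' ≠ 0) :
    ∃ t : ℝ, ∀ y, (if x = y then (1 : ℝ) else 0) - (if x' = y then 1 else 0) = r y * t := by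
  by_cases hxx : x = x'
  · subst hxx
    exact ⟨0, fun y => by simp⟩
  · refine ⟨1 / r x, fun y => ?_⟩
    have h1 := hr _ _ hxx hx hx'
    by_cases hy : x = y
    · subst hy
      rw [if_pos rfl, if_neg (Ne.symm hxx)]
      field_simp
      ring
    by_cases hy' : x' = y
    · subst hy'
      rw [if_neg hy, if_pos rfl, eq_neg_of_add_eq_zero_right h1]
      field_simp
      ring
    · have hy0 : r y = 0 := by
        by_contra hne
        have h2 := hr _ _ hy hx hne
        have h3 := hr _ _ hy' hx' hne
        apply hx
        linarith
      simp [hy, hy', hy0]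

theorem sum_extend_mul {W : Type*} [Fintype W] [DecidableEq W] (p : W → Prop) [DecidablePred p]
    [Fintype {w // p w}] (c : {w // p w} → ℝ) (f : W → ℝ) :
    ∑ w, (if h : p w then c ⟨w, h⟩ else 0) * f w = ∑ i : {w // p w}, c i * f i := by
  have h1 : ∑ w, (if h : p w then c ⟨w, h⟩ else 0) * f w
      = ∑ w with p w, (if h : p w then c ⟨w, h⟩ else 0) * f w := by
    rw [Finset.sum_filter]
    refine Finset.sum_congr rfl fun w _ => ?_
    by_cases h : p w <;> simp [h]
  rw [h1, Finset.sum_subtype (p := p) _ (by simp)]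
  refine Finset.sum_congr rfl fun i _ => ?_
  simp [i.2]

/-! ### Spanning trees and Kirchhoff's voltage law -/

section Graph

variable {W V F : Type*}

/-- The signed incidence matrix of the graph with edges `W` from `tl w` to `hd w`. -/
noncomputable def incidence [DecidableEq V] (hd tl : W → V) (w : W) (v : V) : ℝ :=
  (if v = hd w then 1 else 0) - (if v = tl w then 1 else 0)

theorem sum_incidence_mul [DecidableEq V] [Fintype V] (hd tl : W → V) (w : W) (χ : V → ℝ) :
    ∑ v, incidence hd tl w v * χ v = χ (hd w) - χ (tl w) := by
  simp [incidence, sub_mul, Finset.sum_sub_distrib]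

/-- Summation by parts. A constant `χ` shows that the total divergence is zero; the indicator of a
side of a cut gives the flux through the cut. -/
theorem sum_divergence_mul [DecidableEq V] [Fintype V] [Fintype W] (hd tl : W → V) (c : W → ℝ)
    (χ : V → ℝ) :
    ∑ v, (∑ w, c w * incidence hd tl w v) * χ v = ∑ w, c w * (χ (hd w) - χ (tl w)) := by
  simp_rw [Finset.sum_mul, ← sum_incidence_mul, Finset.mul_sum]
  rw [Finset.sum_comm]
  simp_rw [mul_assoc]

theorem incidence_opposite [DecidableEq V] {hd tl : W → V} (hne : ∀ w, hd w ≠ tl w) (w : W)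
    (x y : V) (hxy : x ≠ y) (hx : incidence hd tl w x ≠ 0) (hy : incidence hd tl w y ≠ 0) :
    incidence hd tl w x + incidence hd tl w y = 0 := by
  have := hne w
  unfold incidence at *
  by_cases h1 : x = hd w <;> by_cases h2 : x = tl w <;> by_cases h3 : y = hd w <;>
    by_cases h4 : y = tl w <;> simp_all

/-- A set of edges that carries no nonzero divergence-free flow. -/
def IsAcyclicEdgeSet [DecidableEq V] [Fintype W] (hd tl : W → V) (S : Finset W) : Prop :=
  ∀ c : W → ℝ, (∀ w, w ∉ S → c w = 0) → (∀ v, ∑ w, c w * incidence hd tl w v = 0) → ∀ w, c w = 0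

/-- The spanning trees, as maximal acyclic sets of edges. -/
def IsSpanningTree [DecidableEq V] [Fintype V] [Fintype W] (hd tl : W → V) (S : Finset W) : Prop :=
  S.card + 1 = Fintype.card V ∧ IsAcyclicEdgeSet hd tl S

/-- The reduced incidence matrix of a spanning tree is invertible. -/
theorem IsSpanningTree.reduced [DecidableEq V] [Fintype V] [Fintype W] [DecidableEq W]
    {hd tl : W → V} {S : Finset W} (hS : IsSpanningTree hd tl S) (u : V) :
    (∃ σ : {w // w ∈ S} ≃ {v // v ≠ u}, ∀ i, incidence hd tl i.1 (σ i) ≠ 0) ∧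
      (∀ y : W → ℝ, ∃ χ : V → ℝ, ∀ w ∈ S, χ (hd w) - χ (tl w) = y w) ∧
      ∀ χ : V → ℝ, (∀ w ∈ S, χ (hd w) - χ (tl w) = 0) → χ u = 0 → ∀ v, χ v = 0 := by
  have hcard : Fintype.card {w // w ∈ S} = Fintype.card {v // v ≠ u} := by
    have := hS.1
    rw [Fintype.card_coe, Fintype.card_subtype_compl, Fintype.card_subtype_eq]
    omega
  have hsum : ∀ (w : W) (x : {v // v ≠ u} → ℝ),
      ∑ j : {v // v ≠ u}, incidence hd tl w j * x j =
        (fun v => if h : v ≠ u then x ⟨v, h⟩ else 0) (hd w) -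
          (fun v => if h : v ≠ u then x ⟨v, h⟩ else 0) (tl w) := by
    intro w x
    rw [← sum_incidence_mul hd tl w (fun v => if h : v ≠ u then x ⟨v, h⟩ else 0)]
    have := sum_extend_mul (fun v => v ≠ u) x (incidence hd tl w)
    simp_rw [mul_comm (incidence hd tl w _)]
    exact this.symm
  obtain ⟨h1, h2, h3⟩ := exists_diagonal_of_vecMul_injective
    (fun (i : {w // w ∈ S}) (j : {v // v ≠ u}) => incidence hd tl i j) hcard (by
      intro c hc
      have hdiv : ∀ v, v ≠ u →
          ∑ w, (if h : w ∈ S then c ⟨w, h⟩ else 0) * incidence hd tl w v = 0 := by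
        intro v hv
        rw [sum_extend_mul (fun w => w ∈ S) c (fun w => incidence hd tl w v)]
        exact hc ⟨v, hv⟩
      -- The divergences sum to zero, so if they vanish off `u` they vanish at `u` too.
      have hall := sum_divergence_mul hd tl (fun w => if h : w ∈ S then c ⟨w, h⟩ else 0)
        (fun _ => 1)
      simp only [sub_self, mul_zero, Finset.sum_const_zero, mul_one] at hall
      rw [Finset.sum_eq_single u (fun v _ hv => hdiv v hv) (by simp)] at hall
      have := hS.2 (fun w => if h : w ∈ S then c ⟨w, h⟩ else 0) (by intro w hw; simp [hw])
        (by
          intro v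
          by_cases hv : v = u
          · subst hv; exact hall
          · exact hdiv v hv)
      ext i
      simpa using this i)
  refine ⟨h1, ?_, ?_⟩
  · intro y
    obtain ⟨x, hx⟩ := h2 (fun i => y i)
    exact ⟨fun v => if h : v ≠ u then x ⟨v, h⟩ else 0, fun w hw => by
      rw [← hx ⟨w, hw⟩, hsum]⟩
  · intro χ hχ hu v
    have := h3 (fun j => χ j) (by
      intro i
      have : ∀ v, (if h : v ≠ u then χ v else 0) = χ v := by
        intro v
        by_cases hv : v = u <;> simp [hv, hu]
      rw [hsum]
      simp only [this]
      exact hχ i i.2)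
    by_cases hv : v = u
    · rw [hv, hu]
    · exact congrFun this ⟨v, hv⟩

/-- Adding an edge to a fixed set of edges: the flow from `u₁` to `u₂` through the added edge, in the
spanning tree so obtained, is a gradient as a function of the added edge. -/
theorem exists_potential_of_insert [DecidableEq V] [Fintype V] [Fintype W] [DecidableEq W]
    {hd tl : W → V} {u₁ u₂ : V} (t : Finset W → W → ℝ)
    (ht0 : ∀ S, IsSpanningTree hd tl S → ∀ w, w ∉ S → t S w = 0)
    (htd : ∀ S, IsSpanningTree hd tl S → ∀ v, ∑ w, t S w * incidence hd tl w v =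
      (if v = u₂ then 1 else 0) - (if v = u₁ then 1 else 0)) (R : Finset W) :
    ∃ χ : V → ℝ, (∀ w ∈ R, χ (hd w) - χ (tl w) = 0) ∧ ∀ w, w ∉ R →
      (IsSpanningTree hd tl (insert w R) → t (insert w R) w = χ (hd w) - χ (tl w)) ∧
      (¬ IsSpanningTree hd tl (insert w R) → χ (hd w) - χ (tl w) = 0) := by
  by_cases hex : ∃ w, w ∉ R ∧ IsSpanningTree hd tl (insert w R)
  swap
  · refine ⟨0, by simp, fun w hw => ⟨fun h => absurd ⟨w, hw, h⟩ hex, by simp⟩⟩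
  obtain ⟨w₀, hw₀, hT⟩ := hex
  obtain ⟨-, hsurj, -⟩ := hT.reduced u₁
  -- `R` is a tree without `w₀`; a potential that is constant along `R` and jumps at `w₀` separates
  -- its two components.
  obtain ⟨ψ, hψ⟩ := hsurj (fun w => if w = w₀ then 1 else 0)
  have hψ0 : ψ (hd w₀) - ψ (tl w₀) = 1 := by simpa using hψ w₀ (by simp)
  have hψR : ∀ w ∈ R, ψ (hd w) = ψ (tl w) := by
    intro w hw
    have := hψ w (by simp [hw])
    rw [if_neg (by rintro rfl; exact hw₀ hw)] at this
    linarith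
  -- the indicator of the component of the head of the added edge
  set I : V → ℝ := fun v => if ψ v = ψ (hd w₀) then 1 else 0 with hI
  have hI0 : I (hd w₀) - I (tl w₀) = 1 := by
    have : ψ (tl w₀) ≠ ψ (hd w₀) := by intro h; rw [h] at hψ0; simp at hψ0
    simp [hI, this]
  have hIR : ∀ w ∈ R, I (hd w) - I (tl w) = 0 := by
    intro w hw
    simp [hI, hψR w hw]
  have hsq : ∀ w, I (hd w) - I (tl w) ≠ 0 → (I (hd w) - I (tl w)) * (I (hd w) - I (tl w)) = 1 := by
    intro w
    simp only [hI]
    split_ifs <;> norm_num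
  -- Only `w` can cross the cut, so the flux out of one side is the flow through `w`.
  have hflow : ∀ w, w ∉ R → ∀ c : W → ℝ, (∀ x, x ∉ insert w R → c x = 0) →
      ∑ v, (∑ w, c w * incidence hd tl w v) * I v = c w * (I (hd w) - I (tl w)) := by
    intro w hw c hc
    rw [sum_divergence_mul]
    refine Finset.sum_eq_single w (fun x _ hx => ?_) (by simp)
    by_cases hxR : x ∈ R
    · rw [hIR x hxR, mul_zero]
    · rw [hc x (by simp [hx, hxR]), zero_mul]
  -- The flow through a crossing edge is `I u₂ - I u₁`, up to the sign of the crossing.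
  refine ⟨fun v => (I u₂ - I u₁) * I v, fun w hw => by rw [← mul_sub, hIR w hw, mul_zero],
    fun w hw => ⟨fun hTw => ?_, fun hTw => ?_⟩⟩
  · have h1 := hflow w hw (t (insert w R)) (ht0 _ hTw)
    simp_rw [htd _ hTw] at h1
    simp only [sub_mul, ite_mul, one_mul, zero_mul, Finset.sum_sub_distrib, Finset.sum_ite_eq',
      Finset.mem_univ, if_true] at h1
    -- Otherwise `I` would be constant along a spanning tree, against its jump at `w₀`.
    have h2 : I (hd w) - I (tl w) ≠ 0 := by
      intro h0
      obtain ⟨-, -, hinj'⟩ := hTw.reduced (tl w₀)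
      have := hinj' (fun v => I v - I (tl w₀)) (by
        intro x hx
        rcases Finset.mem_insert.mp hx with rfl | hx
        · simpa using h0
        · simpa using hIR x hx) (by simp) (hd w₀)
      rw [hI0] at this
      exact one_ne_zero this
    have h3 := hsq w h2
    rw [← mul_sub, h1, mul_assoc, h3, mul_one]
  · rw [← mul_sub]
    by_contra hne
    have h2 : I (hd w) - I (tl w) ≠ 0 := right_ne_zero_of_mul hne
    apply hTw
    refine ⟨?_, ?_⟩
    · rw [← hT.1, Finset.card_insert_of_notMem hw, Finset.card_insert_of_notMem hw₀]
    -- A divergence-free flow has no flux through the cut, so it vanishes on `w` and lives on a part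
    -- of the first tree.
    · intro c hc hdiv
      have h1 := hflow w hw c hc
      simp only [hdiv, zero_mul, Finset.sum_const_zero] at h1
      have hcw : c w = 0 := by
        rcases mul_eq_zero.mp h1.symm with h | h
        · exact h
        · exact absurd h h2
      refine hT.2 c (fun x hx => ?_) hdiv
      by_cases hxw : x = w
      · rw [hxw, hcw]
      · exact hc x (by
          simp only [Finset.mem_insert, not_or] at hx ⊢
          exact ⟨hxw, hx.2⟩)

/-- Kirchhoff's voltage law: the expected flow from `u₁` to `u₂` in a uniform spanning tree is
orthogonal to every cycle. -/
theorem sum_tree_flow_mul_cycle [DecidableEq V] [Fintype V] [Fintype W] [DecidableEq W]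
    {hd tl : W → V} {u₁ u₂ : V} (t : Finset W → W → ℝ) (𝒯 : Finset (Finset W))
    (h𝒯 : ∀ S, S ∈ 𝒯 ↔ IsSpanningTree hd tl S)
    (ht0 : ∀ S, IsSpanningTree hd tl S → ∀ w, w ∉ S → t S w = 0)
    (htd : ∀ S, IsSpanningTree hd tl S → ∀ v, ∑ w, t S w * incidence hd tl w v =
      (if v = u₂ then 1 else 0) - (if v = u₁ then 1 else 0))
    (c : W → ℝ) (hc : ∀ v, ∑ w, c w * incidence hd tl w v = 0) :
    ∑ w, c w * ∑ S ∈ 𝒯, t S w = 0 := by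
  -- The pairs of a tree and one of its edges are grouped by what remains when the edge is deleted;
  -- each group is then paired with a gradient.
  have hregroup : ∑ w, c w * ∑ S ∈ 𝒯, t S w =
      ∑ R : Finset W, ∑ w with (w ∉ R ∧ insert w R ∈ 𝒯), c w * t (insert w R) w := by
    simp_rw [Finset.mul_sum]
    rw [Finset.sum_comm]
    have h1 : ∀ S ∈ 𝒯, ∑ w, c w * t S w = ∑ w ∈ S, c w * t S w := by
      intro S hS
      refine (Finset.sum_subset (Finset.subset_univ S) fun w _ hw => ?_).symm
      rw [ht0 S ((h𝒯 S).mp hS) w hw, mul_zero]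
    rw [Finset.sum_congr rfl h1, Finset.sum_sigma', Finset.sum_sigma']
    refine Finset.sum_bij' (fun x _ => ⟨x.1.erase x.2, x.2⟩) (fun x _ => ⟨insert x.2 x.1, x.2⟩)
      ?_ ?_ ?_ ?_ ?_
    · rintro ⟨S, w⟩ h
      simp only [Finset.mem_sigma] at h
      simp [h.1, h.2, Finset.insert_erase h.2]
    · rintro ⟨R, w⟩ h
      simp only [Finset.mem_sigma, Finset.mem_filter] at h
      simp [h.2.2.2]
    · rintro ⟨S, w⟩ h
      simp only [Finset.mem_sigma] at h
      simp [Finset.insert_erase h.2]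
    · rintro ⟨R, w⟩ h
      simp only [Finset.mem_sigma, Finset.mem_filter] at h
      simp [h.2.2.1]
    · rintro ⟨S, w⟩ h
      simp only [Finset.mem_sigma] at h
      simp [Finset.insert_erase h.2]
  rw [hregroup]
  refine Finset.sum_eq_zero fun R _ => ?_
  obtain ⟨χ, hR, hχ⟩ := exists_potential_of_insert t ht0 htd R
  have : ∑ w with (w ∉ R ∧ insert w R ∈ 𝒯), c w * t (insert w R) w =
      ∑ w, c w * (χ (hd w) - χ (tl w)) := by
    rw [Finset.sum_filter]
    refine Finset.sum_congr rfl fun w _ => ?_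
    by_cases hwR : w ∈ R
    · simp [hwR, hR w hwR]
    · by_cases hwT : insert w R ∈ 𝒯
      · rw [if_pos ⟨hwR, hwT⟩, (hχ w hwR).1 ((h𝒯 _).mp hwT)]
      · rw [if_neg (fun h => hwT h.2), (hχ w hwR).2 (fun h => hwT ((h𝒯 _).mpr h)), mul_zero]
  rw [this, ← sum_divergence_mul]
  simp [hc]

end Graph

/-! ### Matchings of edges with vertices and faces, and their trees -/

section Matching

variable {W V F : Type*}

/-- A perfect matching of the edges `W` with the vertices `V` other than the root `u` and the faces
`F`, along incidences. -/
structure IsRootedMatching (hd tl : W → V) (C : W → F → ℝ) (u : V) (m : W → V ⊕ F) : Prop where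
  injective : Function.Injective m
  avoids : ∀ w, m w ≠ Sum.inl u
  covers : ∀ x, x ≠ Sum.inl u → ∃ w, m w = x
  primal : ∀ w v, m w = Sum.inl v → v = hd w ∨ v = tl w
  dual : ∀ w b, m w = Sum.inr b → C w b ≠ 0

/-- The edges that are matched with vertices. -/
def primalEdges [Fintype W] (m : W → V ⊕ F) : Finset W :=
  Finset.univ.filter fun w => (m w).isLeft

theorem mem_primalEdges [Fintype W] (m : W → V ⊕ F) (w : W) :
    w ∈ primalEdges m ↔ ∃ v, m w = Sum.inl v := by
  simp [primalEdges, Sum.isLeft_iff]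

theorem notMem_primalEdges [Fintype W] (m : W → V ⊕ F) (w : W) :
    w ∉ primalEdges m ↔ ∃ b, m w = Sum.inr b := by
  simp [primalEdges, Sum.isRight_iff]

theorem incidence_ne_zero [DecidableEq V] {hd tl : W → V} (hne : ∀ w, hd w ≠ tl w) {w : W} {v : V} :
    incidence hd tl w v ≠ 0 ↔ v = hd w ∨ v = tl w := by
  have := (hne w).symm
  unfold incidence
  by_cases h1 : v = hd w <;> by_cases h2 : v = tl w <;> simp_all

theorem IsRootedMatching.card_primalEdges [Fintype W] [Fintype V] [DecidableEq V]
    {hd tl : W → V} {C : W → F → ℝ} {u : V} {m : W → V ⊕ F} (hm : IsRootedMatching hd tl C u m) :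
    (primalEdges m).card + 1 = Fintype.card V := by
  classical
  have h1 : (primalEdges m).card = ((Finset.univ : Finset V).erase u).card := by
    have himg : (primalEdges m).map ⟨m, hm.injective⟩ =
        ((Finset.univ : Finset V).erase u).map ⟨Sum.inl, Sum.inl_injective⟩ := by
      ext x
      simp only [Finset.mem_map, mem_primalEdges, Function.Embedding.coeFn_mk, Finset.mem_erase,
        Finset.mem_univ, and_true]
      constructor
      · rintro ⟨w, ⟨v, hv⟩, rfl⟩
        exact ⟨v, fun h => hm.avoids w (by rw [hv, h]), hv.symm⟩
      · rintro ⟨v, hv, rfl⟩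
        obtain ⟨w, hw⟩ := hm.covers (Sum.inl v) (by simpa using hv)
        exact ⟨w, ⟨v, hw⟩, hw⟩
    rw [← Finset.card_map ⟨m, hm.injective⟩, himg, Finset.card_map]
  rw [h1, Finset.card_erase_of_mem (Finset.mem_univ u), Finset.card_univ]
  have : 0 < Fintype.card V := Fintype.card_pos_iff.mpr ⟨u⟩
  omega

/-- Euler's formula, obtained by counting a matching instead of from topology. -/
theorem IsRootedMatching.card_edges [Fintype W] [Fintype V] [Fintype F] [DecidableEq V]
    {hd tl : W → V} {C : W → F → ℝ} {u : V} {m : W → V ⊕ F} (hm : IsRootedMatching hd tl C u m) :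
    Fintype.card W + 1 = Fintype.card V + Fintype.card F := by
  classical
  have himg : (Finset.univ : Finset W).map ⟨m, hm.injective⟩ = Finset.univ.erase (Sum.inl u) := by
    ext x
    simp only [Finset.mem_map, Finset.mem_univ, true_and, Function.Embedding.coeFn_mk,
      Finset.mem_erase, and_true]
    constructor
    · rintro ⟨w, rfl⟩
      exact hm.avoids w
    · exact hm.covers x
  have := congrArg Finset.card himg
  rw [Finset.card_map, Finset.card_erase_of_mem (Finset.mem_univ _), Finset.card_univ,
    Finset.card_univ, Fintype.card_sum] at this
  have : 0 < Fintype.card V := Fintype.card_pos_iff.mpr ⟨u⟩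
  omega

theorem IsRootedMatching.sum_indicator [Fintype W] [DecidableEq V] [DecidableEq F]
    {hd tl : W → V} {C : W → F → ℝ} {u : V} {m : W → V ⊕ F}
    (hm : IsRootedMatching hd tl C u m) (x : V ⊕ F) :
    ∑ w, (if m w = x then (1 : ℝ) else 0) = if x = Sum.inl u then 0 else 1 := by
  split_ifs with h
  · refine Finset.sum_eq_zero fun w _ => if_neg ?_
    rw [h]
    exact hm.avoids w
  · obtain ⟨w, hw⟩ := hm.covers x h
    rw [Finset.sum_eq_single w]
    · simp [hw]
    · intro w' _ hne
      refine if_neg fun h' => hne (hm.injective (h'.trans hw.symm))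
    · simp

open Classical in
/-- The finite set of all rooted matchings. -/
noncomputable def rootedMatchings [Fintype W] [DecidableEq W] [Fintype V] [Fintype F]
    (hd tl : W → V) (C : W → F → ℝ) (u : V) :
    Finset (W → V ⊕ F) :=
  Finset.univ.filter (IsRootedMatching hd tl C u)

theorem mem_rootedMatchings [Fintype W] [DecidableEq W] [Fintype V] [Fintype F]
    {hd tl : W → V} {C : W → F → ℝ} {u : V} {m : W → V ⊕ F} :
    m ∈ rootedMatchings hd tl C u ↔ IsRootedMatching hd tl C u m := by
  simp [rootedMatchings]

variable [Fintype W] [Fintype V] [Fintype F] [DecidableEq W] [DecidableEq V] [DecidableEq F]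

/-- The complement of a spanning tree supports an invertible part of the curl matrix `C`. -/
theorem IsSpanningTree.dual {hd tl : W → V} {C : W → F → ℝ}
    (horth : ∀ b v, ∑ w, C w b * incidence hd tl w v = 0)
    (hinj : ∀ a : F → ℝ, (∀ w, ∑ b, C w b * a b = 0) → a = 0)
    (hcard : Fintype.card W + 1 = Fintype.card V + Fintype.card F) {S : Finset W}
    (hS : IsSpanningTree hd tl S) :
    (∃ σ : F ≃ {w // w ∉ S}, ∀ b, C (σ b) b ≠ 0) ∧
      ∀ t : W → ℝ, (∀ w ∈ S, t w = 0) → (∀ b, ∑ w, t w * C w b = 0) → ∀ w, t w = 0 := by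
  have hc : Fintype.card F = Fintype.card {w // w ∉ S} := by
    rw [Fintype.card_subtype_compl, Fintype.card_coe]
    have := hS.1
    omega
  obtain ⟨h1, -, h3⟩ := exists_diagonal_of_vecMul_injective
    (fun (b : F) (w : {w // w ∉ S}) => C w b) hc (by
      intro a ha
      apply hinj
      -- A combination of face circulations that vanishes off `S` is a divergence-free flow on the
      -- tree, hence zero.
      have := hS.2 (fun w => ∑ b, C w b * a b) (by
        intro w hw
        rw [← ha ⟨w, hw⟩]
        exact Finset.sum_congr rfl fun b _ => mul_comm _ _) (by
        intro v
        simp_rw [Finset.sum_mul]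
        rw [Finset.sum_comm]
        refine Finset.sum_eq_zero fun b _ => ?_
        have h := horth b v
        calc ∑ w, C w b * a b * incidence hd tl w v
            = a b * ∑ w, C w b * incidence hd tl w v := by
              rw [Finset.mul_sum]
              exact Finset.sum_congr rfl fun w _ => by ring
          _ = 0 := by rw [h, mul_zero])
      exact this)
  refine ⟨h1, fun t ht0 ht w => ?_⟩
  have := h3 (fun w => t w) (by
    intro b
    rw [← ht b, ← sum_extend_mul (fun w => w ∉ S) (fun w => C w b) t]
    refine Finset.sum_congr rfl fun w _ => ?_
    by_cases hw : w ∈ S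
    · simp [hw, ht0 w hw]
    · simp [hw, mul_comm])
  by_cases hw : w ∈ S
  · exact ht0 w hw
  · exact congrFun this ⟨w, hw⟩

/-- Nonvanishing diagonals of the reduced incidence matrix on `S` and of the curl matrix off `S`
give the two halves of the matching. -/
theorem IsSpanningTree.exists_rootedMatching {hd tl : W → V} (hne : ∀ w, hd w ≠ tl w)
    {C : W → F → ℝ}
    (horth : ∀ b v, ∑ w, C w b * incidence hd tl w v = 0)
    (hinj : ∀ a : F → ℝ, (∀ w, ∑ b, C w b * a b = 0) → a = 0)
    (hcard : Fintype.card W + 1 = Fintype.card V + Fintype.card F) {S : Finset W}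
    (hS : IsSpanningTree hd tl S) (u : V) :
    ∃ m, IsRootedMatching hd tl C u m ∧ primalEdges m = S := by
  obtain ⟨⟨σ, hσ⟩, -⟩ := hS.reduced u
  obtain ⟨⟨τ, hτ⟩, -⟩ := hS.dual horth hinj hcard
  let m : W → V ⊕ F := fun w => if h : w ∈ S then Sum.inl (σ ⟨w, h⟩) else Sum.inr (τ.symm ⟨w, h⟩)
  have hm1 : ∀ w (h : w ∈ S), m w = Sum.inl (σ ⟨w, h⟩).1 := fun w h => by simp [m, h]
  have hm2 : ∀ w (h : w ∉ S), m w = Sum.inr (τ.symm ⟨w, h⟩) := fun w h => by simp [m, h]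
  refine ⟨m, ⟨?_, ?_, ?_, ?_, ?_⟩, ?_⟩
  · intro w w' hww
    by_cases h : w ∈ S <;> by_cases h' : w' ∈ S
    · rw [hm1 w h, hm1 w' h', Sum.inl.injEq] at hww
      simpa using σ.injective (Subtype.ext hww)
    · rw [hm1 w h, hm2 w' h'] at hww
      simp at hww
    · rw [hm2 w h, hm1 w' h'] at hww
      simp at hww
    · rw [hm2 w h, hm2 w' h', Sum.inr.injEq] at hww
      simpa using τ.symm.injective hww
  · intro w
    by_cases h : w ∈ S
    · rw [hm1 w h]
      simpa using (σ ⟨w, h⟩).2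
    · rw [hm2 w h]
      simp
  · rintro (v | b) hx
    · have hv : v ≠ u := by simpa using hx
      refine ⟨(σ.symm ⟨v, hv⟩).1, ?_⟩
      rw [hm1 _ (σ.symm ⟨v, hv⟩).2]
      simp
    · refine ⟨(τ b).1, ?_⟩
      rw [hm2 _ (τ b).2]
      simp
  · intro w v hv
    by_cases h : w ∈ S
    · rw [hm1 w h, Sum.inl.injEq] at hv
      rw [← hv]
      exact (incidence_ne_zero hne).mp (hσ ⟨w, h⟩)
    · rw [hm2 w h] at hv
      simp at hv
  · intro w b hb
    by_cases h : w ∈ S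
    · rw [hm1 w h] at hb
      simp at hb
    · rw [hm2 w h, Sum.inr.injEq] at hb
      rw [← hb]
      simpa using hτ (τ.symm ⟨w, h⟩)
  · ext w
    rw [mem_primalEdges]
    by_cases h : w ∈ S
    · simp [h, hm1 w h]
    · simp [h, hm2 w h]

/-- Two rooted matchings with the same spanning tree agree off the tree, and on the tree they differ
by a flow between the roots. -/
theorem IsSpanningTree.compare {hd tl : W → V} (hne : ∀ w, hd w ≠ tl w)
    {C : W → F → ℝ} (hopp : ∀ w x y, x ≠ y → C w x ≠ 0 → C w y ≠ 0 → C w x + C w y = 0)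
    (horth : ∀ b v, ∑ w, C w b * incidence hd tl w v = 0)
    (hinj : ∀ a : F → ℝ, (∀ w, ∑ b, C w b * a b = 0) → a = 0)
    (hcard : Fintype.card W + 1 = Fintype.card V + Fintype.card F) {S : Finset W}
    (hS : IsSpanningTree hd tl S) {u₁ u₂ : V} {m₁ m₂ : W → V ⊕ F}
    (hm₁ : IsRootedMatching hd tl C u₁ m₁) (hm₂ : IsRootedMatching hd tl C u₂ m₂)
    (hS₁ : primalEdges m₁ = S) (hS₂ : primalEdges m₂ = S) :
    (∀ w, w ∉ S → m₁ w = m₂ w) ∧ ∃ t : W → ℝ, (∀ w, w ∉ S → t w = 0) ∧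
      (∀ w v, (if m₁ w = Sum.inl v then (1 : ℝ) else 0) - (if m₂ w = Sum.inl v then 1 else 0) =
        incidence hd tl w v * t w) ∧
      ∀ v, ∑ w, t w * incidence hd tl w v =
        (if v = u₂ then 1 else 0) - (if v = u₁ then 1 else 0) := by
  constructor
  · have hrow : ∀ w, ∃ t : ℝ, (w ∈ S → t = 0) ∧ ∀ b, (if m₁ w = Sum.inr b then (1 : ℝ) else 0) -
        (if m₂ w = Sum.inr b then 1 else 0) = C w b * t := by
      intro w
      by_cases hw : w ∈ S
      · obtain ⟨v, hv⟩ := (mem_primalEdges m₁ w).mp (hS₁ ▸ hw)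
        obtain ⟨v', hv'⟩ := (mem_primalEdges m₂ w).mp (hS₂ ▸ hw)
        exact ⟨0, fun _ => rfl, fun b => by simp [hv, hv']⟩
      · obtain ⟨b, hb⟩ := (notMem_primalEdges m₁ w).mp (hS₁ ▸ hw)
        obtain ⟨b', hb'⟩ := (notMem_primalEdges m₂ w).mp (hS₂ ▸ hw)
        obtain ⟨t, ht⟩ := exists_indicator_sub_eq_mul (C w) (hopp w) (hm₁.dual w b hb)
          (hm₂.dual w b' hb')
        exact ⟨t, fun h => absurd h hw, fun y => by simpa [hb, hb'] using ht y⟩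
    choose t ht0 ht using hrow
    -- Both matchings cover each face once, so the multipliers are in the kernel of the invertible
    -- curl matrix off `S`.
    have hzero := (hS.dual horth hinj hcard).2 t ht0 (by
      intro b
      have : ∀ w, t w * C w b = (if m₁ w = Sum.inr b then (1 : ℝ) else 0) -
        (if m₂ w = Sum.inr b then 1 else 0) := fun w => by rw [ht, mul_comm]
      simp_rw [this]
      rw [Finset.sum_sub_distrib, hm₁.sum_indicator, hm₂.sum_indicator]
      simp)
    intro w hw
    obtain ⟨b, hb⟩ := (notMem_primalEdges m₁ w).mp (hS₁ ▸ hw)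
    have := ht w b
    rw [hzero w, mul_zero, if_pos hb] at this
    by_contra hne'
    rw [if_neg (fun h => hne' (hb.trans h.symm))] at this
    norm_num at this
  · have hrow : ∀ w, ∃ t : ℝ, (w ∉ S → t = 0) ∧ ∀ v, (if m₁ w = Sum.inl v then (1 : ℝ) else 0) -
        (if m₂ w = Sum.inl v then 1 else 0) = incidence hd tl w v * t := by
      intro w
      by_cases hw : w ∈ S
      · obtain ⟨v, hv⟩ := (mem_primalEdges m₁ w).mp (hS₁ ▸ hw)
        obtain ⟨v', hv'⟩ := (mem_primalEdges m₂ w).mp (hS₂ ▸ hw)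
        obtain ⟨t, ht⟩ := exists_indicator_sub_eq_mul (incidence hd tl w)
          (incidence_opposite hne w) ((incidence_ne_zero hne).mpr (hm₁.primal w v hv))
          ((incidence_ne_zero hne).mpr (hm₂.primal w v' hv'))
        exact ⟨t, fun h => absurd hw h, fun y => by simpa [hv, hv'] using ht y⟩
      · obtain ⟨b, hb⟩ := (notMem_primalEdges m₁ w).mp (hS₁ ▸ hw)
        obtain ⟨b', hb'⟩ := (notMem_primalEdges m₂ w).mp (hS₂ ▸ hw)
        exact ⟨0, fun _ => rfl, fun b => by simp [hb, hb']⟩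
    choose t ht0 ht using hrow
    refine ⟨t, ht0, ht, fun v => ?_⟩
    have : ∀ w, t w * incidence hd tl w v = (if m₁ w = Sum.inl v then (1 : ℝ) else 0) -
        (if m₂ w = Sum.inl v then 1 else 0) := fun w => by rw [ht, mul_comm]
    simp_rw [this]
    rw [Finset.sum_sub_distrib, hm₁.sum_indicator, hm₂.sum_indicator]
    simp only [Sum.inl.injEq]
    split_ifs <;> norm_num

/-- For equal roots the comparison flow is divergence-free on a tree, so it is zero. -/
theorem IsSpanningTree.rootedMatching_unique {hd tl : W → V} (hne : ∀ w, hd w ≠ tl w)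
    {C : W → F → ℝ} (hopp : ∀ w x y, x ≠ y → C w x ≠ 0 → C w y ≠ 0 → C w x + C w y = 0)
    (horth : ∀ b v, ∑ w, C w b * incidence hd tl w v = 0)
    (hinj : ∀ a : F → ℝ, (∀ w, ∑ b, C w b * a b = 0) → a = 0)
    (hcard : Fintype.card W + 1 = Fintype.card V + Fintype.card F) {S : Finset W}
    (hS : IsSpanningTree hd tl S) {u : V} {m₁ m₂ : W → V ⊕ F}
    (hm₁ : IsRootedMatching hd tl C u m₁) (hm₂ : IsRootedMatching hd tl C u m₂)
    (hS₁ : primalEdges m₁ = S) (hS₂ : primalEdges m₂ = S) : m₁ = m₂ := by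
  obtain ⟨hoff, t, ht0, ht, hdiv⟩ := hS.compare hne hopp horth hinj hcard hm₁ hm₂ hS₁ hS₂
  have hz := hS.2 t ht0 (fun v => by rw [hdiv, sub_self])
  ext1 w
  by_cases hw : w ∈ S
  · obtain ⟨v, hv⟩ := (mem_primalEdges m₁ w).mp (hS₁ ▸ hw)
    have := ht w v
    rw [hz w, mul_zero, if_pos hv] at this
    by_contra hne'
    rw [if_neg (fun h => hne' (hv.trans h.symm))] at this
    norm_num at this
  · exact hoff w hw

/-- Comparison of the rooted matchings for two roots: the matching probabilities of the faces do not
depend on the root, and those of the vertices differ by a flow without curl. -/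
theorem exists_curl_free_flow {hd tl : W → V} (hne : ∀ w, hd w ≠ tl w)
    {C : W → F → ℝ} (hopp : ∀ w x y, x ≠ y → C w x ≠ 0 → C w y ≠ 0 → C w x + C w y = 0)
    (horth : ∀ b v, ∑ w, C w b * incidence hd tl w v = 0)
    (hinj : ∀ a : F → ℝ, (∀ w, ∑ b, C w b * a b = 0) → a = 0) (u₁ u₂ : V)
    (hcard : Fintype.card W + 1 = Fintype.card V + Fintype.card F)
    (hac : ∀ u, u = u₁ ∨ u = u₂ → ∀ m, IsRootedMatching hd tl C u m →
      IsAcyclicEdgeSet hd tl (primalEdges m)) :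
    (rootedMatchings hd tl C u₁).card = (rootedMatchings hd tl C u₂).card ∧
    (∀ w b, ∑ m ∈ rootedMatchings hd tl C u₁, (if m w = Sum.inr b then (1 : ℝ) else 0) =
      ∑ m ∈ rootedMatchings hd tl C u₂, (if m w = Sum.inr b then (1 : ℝ) else 0)) ∧
    ∃ g : W → ℝ, (∀ b, ∑ w, C w b * g w = 0) ∧
      ∀ w v, ∑ m ∈ rootedMatchings hd tl C u₁, (if m w = Sum.inl v then (1 : ℝ) else 0) -
        ∑ m ∈ rootedMatchings hd tl C u₂, (if m w = Sum.inl v then (1 : ℝ) else 0) =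
          incidence hd tl w v * g w := by
  classical
  have hex : ∀ u S, ∃ m, IsSpanningTree hd tl S → IsRootedMatching hd tl C u m ∧
      primalEdges m = S := by
    intro u S
    by_cases hS : IsSpanningTree hd tl S
    · obtain ⟨m, hm⟩ := hS.exists_rootedMatching hne horth hinj hcard u
      exact ⟨m, fun _ => hm⟩
    · exact ⟨fun _ => Sum.inl u, fun h => absurd h hS⟩
  choose μ hμ using hex
  set 𝒯 : Finset (Finset W) := Finset.univ.filter (IsSpanningTree hd tl) with h𝒯def
  have h𝒯 : ∀ S, S ∈ 𝒯 ↔ IsSpanningTree hd tl S := by simp [h𝒯def]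
  -- Matchings with a given root correspond to spanning trees, so sums over both roots become sums
  -- over the same trees.
  have hsum : ∀ u, u = u₁ ∨ u = u₂ → ∀ f : (W → V ⊕ F) → ℝ,
      ∑ m ∈ rootedMatchings hd tl C u, f m = ∑ S ∈ 𝒯, f (μ u S) := by
    intro u hu f
    refine (Finset.sum_bij' (fun S _ => μ u S) (fun m _ => primalEdges m) ?_ ?_ ?_ ?_ ?_).symm
    · intro S hS
      exact mem_rootedMatchings.mpr (hμ u S ((h𝒯 S).mp hS)).1
    · intro m hm
      have hm := mem_rootedMatchings.mp hm
      exact (h𝒯 _).mpr ⟨hm.card_primalEdges, hac u hu m hm⟩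
    · intro S hS
      exact (hμ u S ((h𝒯 S).mp hS)).2
    · intro m hm
      have hm := mem_rootedMatchings.mp hm
      have hT : IsSpanningTree hd tl (primalEdges m) := ⟨hm.card_primalEdges, hac u hu m hm⟩
      exact hT.rootedMatching_unique hne hopp horth hinj hcard (hμ u _ hT).1 hm (hμ u _ hT).2 rfl
    · intro S _
      rfl
  have h1 := hsum u₁ (Or.inl rfl)
  have h2 := hsum u₂ (Or.inr rfl)
  have hcmp : ∀ S, ∃ t : W → ℝ, IsSpanningTree hd tl S → (∀ w, w ∉ S → t w = 0) ∧
      (∀ w v, (if μ u₁ S w = Sum.inl v then (1 : ℝ) else 0) -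
        (if μ u₂ S w = Sum.inl v then 1 else 0) = incidence hd tl w v * t w) ∧
      ∀ v, ∑ w, t w * incidence hd tl w v =
        (if v = u₂ then 1 else 0) - (if v = u₁ then 1 else 0) := by
    intro S
    by_cases hS : IsSpanningTree hd tl S
    · obtain ⟨t, ht⟩ := (hS.compare hne hopp horth hinj hcard (hμ u₁ S hS).1 (hμ u₂ S hS).1
        (hμ u₁ S hS).2 (hμ u₂ S hS).2).2
      exact ⟨t, fun _ => ht⟩
    · exact ⟨0, fun h => absurd h hS⟩
  choose t ht using hcmp
  refine ⟨?_, ?_, fun w => ∑ S ∈ 𝒯, t S w, ?_, ?_⟩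
  · have := (h1 fun _ => 1).trans (h2 fun _ => 1).symm
    simpa using this
  · intro w b
    rw [h1, h2]
    refine Finset.sum_congr rfl fun S hS => ?_
    have hT := (h𝒯 S).mp hS
    by_cases hw : w ∈ S
    · have hw1 := hw
      have hw2 := hw
      rw [← (hμ u₁ S hT).2, mem_primalEdges] at hw1
      rw [← (hμ u₂ S hT).2, mem_primalEdges] at hw2
      obtain ⟨v, hv⟩ := hw1
      obtain ⟨v', hv'⟩ := hw2
      simp [hv, hv']
    · rw [(hT.compare hne hopp horth hinj hcard (hμ u₁ S hT).1 (hμ u₂ S hT).1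
        (hμ u₁ S hT).2 (hμ u₂ S hT).2).1 w hw]
  · intro b
    exact sum_tree_flow_mul_cycle t 𝒯 h𝒯 (fun S hS => (ht S hS).1) (fun S hS => (ht S hS).2.2)
      (fun w => C w b) (horth b)
  · intro w v
    rw [h1, h2, ← Finset.sum_sub_distrib, Finset.mul_sum]
    exact Finset.sum_congr rfl fun S hS => (ht S ((h𝒯 S).mp hS)).2.1 w v

end Matching

/-! ### Boundary geometry of an odd Temperley domain -/

theorem exists_bound (D : Finset Face) :
    ∃ N : ℤ, ∀ f ∈ D, -N ≤ f.1 ∧ f.1 ≤ N ∧ -N ≤ f.2 ∧ f.2 ≤ N := by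
  refine ⟨∑ f ∈ D, (|f.1| + |f.2|), fun f hf => ?_⟩
  have h := Finset.single_le_sum (f := fun f : Face => |f.1| + |f.2|)
    (fun g _ => by positivity) hf
  have h1 := abs_le.mp (le_refl |f.1|)
  have h2 := abs_le.mp (le_refl |f.2|)
  have h3 := abs_nonneg f.1
  have h4 := abs_nonneg f.2
  omega

section Corner

variable {Ω : Finset Face}

/-- In an odd row, no square has a horizontal side on the boundary. -/
theorem IsOddTemperley.vertical_mem (hΩ : IsOddTemperley Ω) {x y t : ℤ} (ht : t = 1 ∨ t = -1)
    (hy : ¬ Even y) (h : (x, y) ∈ Ω) : (x, y + t) ∈ Ω := by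
  by_contra hn
  have htm : t ∈ ({1, -1} : Set ℤ) := by simpa using ht
  have hs : (1 : ℤ) ∈ ({1, -1} : Set ℤ) := by simp
  have hs' : (-1 : ℤ) ∈ ({1, -1} : Set ℤ) := by simp
  -- The boundary side continues east forever: it could only end at a convex or concave corner whose
  -- square lies in an odd row, or at a diagonal contact. This contradicts finiteness.
  have key : ∀ n : ℕ, (x + n, y) ∈ Ω ∧ (x + n, y + t) ∉ Ω := by
    intro n
    induction n with
    | zero => simpa using ⟨h, hn⟩
    | succ n ih =>
      obtain ⟨h1, h2⟩ := ih
      have e : x + ((n + 1 : ℕ) : ℤ) = x + n + 1 := by push_cast; ring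
      rw [e]
      generalize x + (n : ℤ) = p at *
      by_cases h3 : (p + 1, y) ∈ Ω
      · refine ⟨h3, fun h4 => ?_⟩
        have hc : IsCornerSquare Ω (p + 1, y) :=
          ⟨h3, -1, hs', t, htm, by simpa using h2, Or.inr ⟨by simpa using h1, by simpa using h4⟩⟩
        exact hy (hΩ.corner _ hc).2
      · exfalso
        by_cases h4 : (p + 1, y + t) ∈ Ω
        · rcases hΩ.domain.simple_boundary (p, y) 1 hs t htm h1 (by simpa using h4) with h | h
          · exact h3 (by simpa using h)
          · exact h2 (by simpa using h)
        · have hc : IsCornerSquare Ω (p, y) :=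
            ⟨h1, 1, hs, t, htm, by simpa using h4, Or.inl ⟨by simpa using h3, by simpa using h2⟩⟩
          exact hy (hΩ.corner _ hc).2
  obtain ⟨N, hN⟩ := exists_bound Ω
  have := (hN _ (key (N - x + 1).toNat).1).2.1
  have h2 := Int.self_le_toNat (N - x + 1)
  simp only at this
  omega

/-- In an odd column, no square has a vertical side on the boundary. -/
theorem IsOddTemperley.horizontal_mem (hΩ : IsOddTemperley Ω) {x y s : ℤ} (ht : s = 1 ∨ s = -1)
    (hy : ¬ Even x) (h : (x, y) ∈ Ω) : (x + s, y) ∈ Ω := by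
  by_contra hn
  have htm : s ∈ ({1, -1} : Set ℤ) := by simpa using ht
  have hs : (1 : ℤ) ∈ ({1, -1} : Set ℤ) := by simp
  have hs' : (-1 : ℤ) ∈ ({1, -1} : Set ℤ) := by simp
  -- The same propagation, northwards.
  have key : ∀ n : ℕ, (x, y + n) ∈ Ω ∧ (x + s, y + n) ∉ Ω := by
    intro n
    induction n with
    | zero => simpa using ⟨h, hn⟩
    | succ n ih =>
      obtain ⟨h1, h2⟩ := ih
      have e : y + ((n + 1 : ℕ) : ℤ) = y + n + 1 := by push_cast; ring
      rw [e]
      generalize y + (n : ℤ) = p at *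
      by_cases h3 : (x, p + 1) ∈ Ω
      · refine ⟨h3, fun h4 => ?_⟩
        have hc : IsCornerSquare Ω (x, p + 1) :=
          ⟨h3, s, htm, -1, hs', by simpa using h2, Or.inr ⟨by simpa using h4, by simpa using h1⟩⟩
        exact hy (hΩ.corner _ hc).1
      · exfalso
        by_cases h4 : (x + s, p + 1) ∈ Ω
        · rcases hΩ.domain.simple_boundary (x, p) s htm 1 hs h1 (by simpa using h4) with h | h
          · exact h2 (by simpa using h)
          · exact h3 (by simpa using h)
        · have hc : IsCornerSquare Ω (x, p) :=
            ⟨h1, s, htm, 1, hs, by simpa using h4, Or.inl ⟨by simpa using h2, by simpa using h3⟩⟩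
          exact hy (hΩ.corner _ hc).1
  obtain ⟨N, hN⟩ := exists_bound Ω
  have := (hN _ (key (N - y + 1).toNat).1).2.2.2
  have h2 := Int.self_le_toNat (N - y + 1)
  simp only at this
  omega

end Corner

/-! ### Parity classes and the neighbours of white squares -/

/-- The squares with both coordinates congruent to `k` modulo `2`. -/
def IsClass (k : ℤ) (f : Face) : Prop := Even (f.1 - k) ∧ Even (f.2 - k)

/-- The direction from a white square to its neighbours of class `k`. -/
def axis (k : ℤ) (w : Face) : ℤ × ℤ := if Even (w.1 - k) then (0, 1) else (1, 0)

theorem axis_cases {k : ℤ} {w : Face} (hw : ¬ IsBlack w) :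
    (axis k w = (0, 1) ∧ axis (k + 1) w = (1, 0) ∧ Even (w.1 - k) ∧ ¬ Even (w.2 - k)) ∨
      (axis k w = (1, 0) ∧ axis (k + 1) w = (0, 1) ∧ ¬ Even (w.1 - k) ∧ Even (w.2 - k)) := by
  unfold IsBlack at hw
  unfold axis
  have h : Even (w.1 - (k + 1)) ↔ ¬ Even (w.1 - k) := by
    rw [Int.even_iff, Int.even_iff]; omega
  by_cases h1 : Even (w.1 - k)
  · left
    refine ⟨if_pos h1, if_neg (by rw [h]; simpa using h1), h1, ?_⟩
    rw [Int.even_iff] at *; omega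
  · right
    refine ⟨if_neg h1, if_pos (by rw [h]; simpa using h1), h1, ?_⟩
    rw [Int.even_iff] at *; omega

theorem IsClass.isBlack {k : ℤ} {f : Face} (h : IsClass k f) : IsBlack f := by
  obtain ⟨h1, h2⟩ := h
  unfold IsBlack
  rw [Int.even_iff] at *; omega

theorem IsClass.not_succ {k : ℤ} {f : Face} (h : IsClass k f) : ¬ IsClass (k + 1) f := by
  rintro ⟨h1, -⟩
  obtain ⟨h2, -⟩ := h
  rw [Int.even_iff] at *; omega

theorem isClass_add_axis {k : ℤ} {w : Face} (hw : ¬ IsBlack w) : IsClass k (w + axis k w) := by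
  rcases axis_cases (k := k) hw with ⟨h, -, h1, h2⟩ | ⟨h, -, h1, h2⟩ <;> rw [h] <;>
    unfold IsClass <;> simp only [Prod.fst_add, Prod.snd_add, Int.even_iff] at * <;> omega

theorem isClass_sub_axis {k : ℤ} {w : Face} (hw : ¬ IsBlack w) : IsClass k (w - axis k w) := by
  rcases axis_cases (k := k) hw with ⟨h, -, h1, h2⟩ | ⟨h, -, h1, h2⟩ <;> rw [h] <;>
    unfold IsClass <;> simp only [Prod.fst_sub, Prod.snd_sub, Int.even_iff] at * <;> omega

theorem eq_axis_of_adj {k : ℤ} {w b : Face} (hw : ¬ IsBlack w) (hb : IsClass k b)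
    (h : faceGraph.Adj b w) : b = w + axis k w ∨ b = w - axis k w := by
  obtain ⟨b1, b2⟩ := b
  obtain ⟨w1, w2⟩ := w
  obtain ⟨hb1, hb2⟩ := hb
  rcases axis_cases (k := k) hw with ⟨e, -, h1, h2⟩ | ⟨e, -, h1, h2⟩ <;> rw [e] <;>
    simp only [faceGraph, Int.even_iff, Prod.mk_add_mk, Prod.mk_sub_mk, Prod.mk.injEq] at * <;>
    omega

/-- Exactly one coordinate of `w` is odd, and `axis 0 w` moves that one: in an odd row or column no
boundary side blocks the move. -/
theorem IsOddTemperley.axis_mem {Ω : Finset Face} (hΩ : IsOddTemperley Ω) {w : Face} (h : w ∈ Ω)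
    (hw : ¬ IsBlack w) : w + axis 0 w ∈ Ω ∧ w - axis 0 w ∈ Ω := by
  obtain ⟨x, y⟩ := w
  rcases axis_cases (k := 0) hw with ⟨e, -, h1, h2⟩ | ⟨e, -, h1, h2⟩ <;> rw [e]
  · have h3 := hΩ.vertical_mem (Or.inl rfl) (by simpa using h2) h
    have h4 := hΩ.vertical_mem (Or.inr rfl) (by simpa using h2) h
    simpa [sub_eq_add_neg] using And.intro h3 h4
  · have h3 := hΩ.horizontal_mem (Or.inl rfl) (by simpa using h1) h
    have h4 := hΩ.horizontal_mem (Or.inr rfl) (by simpa using h1) h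
    simpa [sub_eq_add_neg] using And.intro h3 h4

/-- Both coordinates are odd, so no side is on the boundary. -/
theorem IsOddTemperley.adj_mem {Ω : Finset Face} (hΩ : IsOddTemperley Ω) {b : Face} (h : b ∈ Ω)
    (hb : IsClass 1 b) {f : Face} (hf : faceGraph.Adj b f) : f ∈ Ω := by
  obtain ⟨x, y⟩ := b
  obtain ⟨p, q⟩ := f
  obtain ⟨h1, h2⟩ := hb
  have hx : ¬ Even x := by rw [Int.even_iff] at *; simp only at h1; omega
  have hy : ¬ Even y := by rw [Int.even_iff] at *; simp only at h2; omega
  have a1 := hΩ.vertical_mem (Or.inl rfl) hy h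
  have a2 := hΩ.vertical_mem (Or.inr rfl) hy h
  have a3 := hΩ.horizontal_mem (Or.inl rfl) hx h
  have a4 := hΩ.horizontal_mem (Or.inr rfl) hx h
  simp only [faceGraph] at hf
  rcases hf with ⟨rfl, rfl | rfl⟩ | ⟨rfl, rfl | rfl⟩
  · simpa using a2
  · exact a1
  · simpa using a4
  · exact a3

theorem IsBlack.isClass {b : Face} (h : IsBlack b) : IsClass 0 b ∨ IsClass 1 b := by
  unfold IsBlack at h
  unfold IsClass
  simp only [Int.even_iff] at *
  omega

theorem IsOddTemperley.boundaryBlack_class {Ω : Finset Face} (hΩ : IsOddTemperley Ω) {u : Face}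
    (hu : IsBoundaryBlack Ω u) : IsClass 0 u := by
  obtain ⟨h1, h2, f, hf, hn⟩ := hu
  rcases h2.isClass with h | h
  · exact h
  · exact absurd (hΩ.adj_mem h1 h hf) hn

/-! ### Flows on matched squares vanish: descent through their potentials -/

section Flow

/-- The net flow out of `b` into its four neighbours, a flow on the white squares being counted
positively towards east and north. -/
def divergence (c : Face → ℝ) (b : Face) : ℝ :=
  c (b.1 + 1, b.2) + c (b.1, b.2 + 1) - c (b.1 - 1, b.2) - c (b.1, b.2 - 1)

/-- The flow through the horizontal ray to the east of a square. -/
noncomputable def rayFlow (Ω : Finset Face) (c : Face → ℝ) (g : Face) : ℝ :=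
  ∑ w ∈ Ω with w.2 = g.2 ∧ g.1 < w.1, c w

variable {Ω : Finset Face} {c : Face → ℝ} {k : ℤ}

theorem rayFlow_succ (hΩ : ∀ w, c w ≠ 0 → w ∈ Ω) (p q : ℤ) :
    rayFlow Ω c (p, q) = c (p + 1, q) + rayFlow Ω c (p + 1, q) := by
  unfold rayFlow
  simp only
  by_cases h : (p + 1, q) ∈ Ω
  · rw [← Finset.sum_insert (s := Ω.filter fun w => w.2 = q ∧ p + 1 < w.1) (f := c)
      (a := ((p + 1, q) : Face)) (by simp)]
    refine Finset.sum_congr ?_ fun _ _ => rfl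
    ext ⟨x, y⟩
    simp only [Finset.mem_filter, Finset.mem_insert, Prod.mk.injEq]
    constructor
    · rintro ⟨h1, h2, h3⟩
      by_cases h4 : x = p + 1
      · exact Or.inl ⟨h4, h2⟩
      · exact Or.inr ⟨h1, h2, by omega⟩
    · rintro (⟨rfl, rfl⟩ | ⟨h1, h2, h3⟩)
      · exact ⟨h, rfl, by omega⟩
      · exact ⟨h1, h2, by omega⟩
  · have h0 : c (p + 1, q) = 0 := by
      by_contra h'
      exact h (hΩ _ h')
    rw [h0, zero_add]
    refine Finset.sum_congr ?_ fun _ _ => rfl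
    ext ⟨x, y⟩
    simp only [Finset.mem_filter]
    constructor
    · rintro ⟨h1, h2, h3⟩
      refine ⟨h1, h2, ?_⟩
      by_contra h4
      apply h
      have : x = p + 1 := by omega
      rwa [← this, ← h2]
    · rintro ⟨h1, h2, h3⟩
      exact ⟨h1, h2, by omega⟩

theorem exists_of_rayFlow_ne_zero {g : Face} (h : rayFlow Ω c g ≠ 0) : ∃ w, c w ≠ 0 ∧ g.1 < w.1 := by
  obtain ⟨w, hw, hc⟩ := Finset.exists_ne_zero_of_sum_ne_zero h
  exact ⟨w, hc, (Finset.mem_filter.mp hw).2.2⟩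

theorem rayFlow_horizontal (hΩ : ∀ w, c w ≠ 0 → w ∈ Ω) (hwhite : ∀ w, IsBlack w → c w = 0)
    {x y : ℤ} (h : ¬ IsBlack (x, y)) :
    rayFlow Ω c (x - 1, y) - rayFlow Ω c (x + 1, y) = c (x, y) := by
  have h1 := rayFlow_succ hΩ (x - 1) y
  have h2 := rayFlow_succ hΩ x y
  have h3 : c (x + 1, y) = 0 := hwhite _ (by
    unfold IsBlack at *; rw [Int.even_iff] at *; simp only at *; omega)
  rw [sub_add_cancel] at h1
  linarith

/-- The defect in the identity does not change when `x` grows by `2`, by conservation at the class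
`k` square in between, and it is zero east of the domain. -/
theorem rayFlow_vertical (hΩ : ∀ w, c w ≠ 0 → w ∈ Ω) (hwhite : ∀ w, IsBlack w → c w = 0)
    (hdiv : ∀ b, IsClass k b → divergence c b = 0) {x y : ℤ} (hx : ¬ Even (x - k))
    (hy : Even (y - k)) :
    rayFlow Ω c (x, y + 1) - rayFlow Ω c (x, y - 1) = c (x, y) := by
  have step : ∀ x : ℤ, ¬ Even (x - k) →
      rayFlow Ω c (x, y + 1) - rayFlow Ω c (x, y - 1) - c (x, y) =
      rayFlow Ω c (x + 2, y + 1) - rayFlow Ω c (x + 2, y - 1) - c (x + 2, y) := by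
    intro x hx
    have h1 := rayFlow_horizontal hΩ hwhite (x := x + 1) (y := y + 1)
      (by unfold IsBlack; rw [Int.even_iff] at *; simp only at *; omega)
    have h2 := rayFlow_horizontal hΩ hwhite (x := x + 1) (y := y - 1)
      (by unfold IsBlack; rw [Int.even_iff] at *; simp only at *; omega)
    have h3 := hdiv (x + 1, y) (by unfold IsClass; simp only [Int.even_iff] at *; omega)
    unfold divergence at h3
    simp only [add_sub_cancel_right] at h1 h2 h3
    have e : x + 1 + 1 = x + 2 := by ring
    rw [e] at h1 h2 h3
    linarith
  have steps : ∀ n : ℕ, rayFlow Ω c (x, y + 1) - rayFlow Ω c (x, y - 1) - c (x, y) =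
      rayFlow Ω c (x + 2 * n, y + 1) - rayFlow Ω c (x + 2 * n, y - 1) - c (x + 2 * n, y) := by
    intro n
    induction n with
    | zero => simp
    | succ n ih =>
      rw [ih, step (x + 2 * n) (by rw [Int.even_iff] at *; omega)]
      push_cast
      ring_nf
  obtain ⟨N, hN⟩ := exists_bound Ω
  have hfar : ∀ p q, N < p → c (p, q) = 0 := by
    intro p q hp
    by_contra h
    have := (hN _ (hΩ _ h)).2.1
    simp only at this
    omega
  have hfar' : ∀ p q, N < p → rayFlow Ω c (p, q) = 0 := by
    intro p q hp
    by_contra h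
    obtain ⟨w, hw, hlt⟩ := exists_of_rayFlow_ne_zero h
    apply hw
    exact hfar w.1 w.2 (by simp only at hlt; omega)
  have h := steps (N - x + 1).toNat
  have h2 := Int.self_le_toNat (N - x + 1)
  have h3 : N < x + 2 * ((N - x + 1).toNat : ℤ) := by
    have := Int.natCast_nonneg (N - x + 1).toNat
    omega
  rw [hfar _ _ h3, hfar' _ _ h3, hfar' _ _ h3] at h
  linarith

/-- Across a white square, the potential of a divergence-free flow jumps by the flow. -/
theorem rayFlow_jump (hΩ : ∀ w, c w ≠ 0 → w ∈ Ω) (hwhite : ∀ w, IsBlack w → c w = 0)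
    (hdiv : ∀ b, IsClass k b → divergence c b = 0) {w : Face} (hw : ¬ IsBlack w) :
    rayFlow Ω c (w + axis (k + 1) w) = rayFlow Ω c (w - axis (k + 1) w) ↔ c w = 0 := by
  obtain ⟨x, y⟩ := w
  rcases axis_cases (k := k) hw with ⟨-, e, h1, h2⟩ | ⟨-, e, h1, h2⟩ <;> rw [e]
  · have := rayFlow_horizontal hΩ hwhite hw
    simp only [Prod.mk_add_mk, Prod.mk_sub_mk, add_zero, sub_zero]
    constructor <;> intro h <;> linarith
  · have := rayFlow_vertical hΩ hwhite hdiv h1 h2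
    simp only [Prod.mk_add_mk, Prod.mk_sub_mk, add_zero, sub_zero]
    constructor <;> intro h <;> linarith

/-- The potential vanishes at and next to the squares outside of the domain. -/
theorem rayFlow_outside (hconn : (faceGraph.induce {f : Face | f ∉ Ω}).Connected)
    (hwhite : ∀ w, IsBlack w → c w = 0)
    (hΩ : ∀ w, c w ≠ 0 → w ∈ Ω ∧ w + axis k w ∈ Ω ∧ w - axis k w ∈ Ω)
    (hdiv : ∀ b, IsClass k b → divergence c b = 0) {f : Face} (hf : f ∉ Ω) {g : Face}
    (hg : IsClass (k + 1) g) (h1 : |g.1 - f.1| ≤ 1) (h2 : |g.2 - f.2| ≤ 1) :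
    rayFlow Ω c g = 0 := by
  have hΩ' : ∀ w, c w ≠ 0 → w ∈ Ω := fun w h => (hΩ w h).1
  have hH : ∀ x y : ℤ, c (x, y) = 0 → ¬ IsBlack (x, y) →
      rayFlow Ω c (x - 1, y) = rayFlow Ω c (x + 1, y) := by
    intro x y hc hb
    have := rayFlow_horizontal hΩ' hwhite hb
    linarith
  have hV : ∀ x y : ℤ, ¬ Even (x - k) → c (x, y) = 0 → Even (y - k) →
      rayFlow Ω c (x, y - 1) = rayFlow Ω c (x, y + 1) := by
    intro x y hx hc hy
    have := rayFlow_vertical hΩ' hwhite hdiv hx hy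
    linarith
  -- the potential is constant around each square outside
  have hconst : ∀ f, f ∉ Ω → ∀ g g', IsClass (k + 1) g → IsClass (k + 1) g' → |g.1 - f.1| ≤ 1 →
      |g.2 - f.2| ≤ 1 → |g'.1 - f.1| ≤ 1 → |g'.2 - f.2| ≤ 1 →
      rayFlow Ω c g = rayFlow Ω c g' := by
    rintro ⟨x, y⟩ hf ⟨p, q⟩ ⟨p', q'⟩ ⟨hp, hq⟩ ⟨hp', hq'⟩ a1 a2 a3 a4
    simp only [abs_le, Int.even_iff] at *
    by_cases hx : (x - k) % 2 = 0 <;> by_cases hy : (y - k) % 2 = 0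
    -- Around an outer square of class `k` nothing flows, because edges carrying flow have both ends
    -- in `Ω`; hence no jump between its four diagonal neighbours.
    · have hz : ∀ w, ¬ IsBlack w → ((x, y) = w + axis k w ∨ (x, y) = w - axis k w) → c w = 0 := by
        intro w _ h
        by_contra hc
        obtain ⟨-, b1, b2⟩ := hΩ w hc
        rcases h with h | h
        · exact hf (h ▸ b1)
        · exact hf (h ▸ b2)
      have adj : ∀ w, ¬ IsBlack w → faceGraph.Adj (x, y) w → c w = 0 := fun w hw ha =>
        hz w hw (eq_axis_of_adj hw ⟨Int.even_iff.mpr hx, Int.even_iff.mpr hy⟩ ha)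
      have cE := adj (x + 1, y) (by unfold IsBlack; rw [Int.even_iff]; simp only; omega)
        (by simp [faceGraph])
      have cW := adj (x - 1, y) (by unfold IsBlack; rw [Int.even_iff]; simp only; omega)
        (by simp [faceGraph])
      have cN := adj (x, y + 1) (by unfold IsBlack; rw [Int.even_iff]; simp only; omega)
        (by simp [faceGraph])
      have cS := adj (x, y - 1) (by unfold IsBlack; rw [Int.even_iff]; simp only; omega)
        (by simp [faceGraph])
      have rE := hV (x + 1) y (by omega) cE hy
      have rW := hV (x - 1) y (by omega) cW hy
      have rN := hH x (y + 1) cN (by unfold IsBlack; rw [Int.even_iff]; simp only; omega)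
      have rS := hH x (y - 1) cS (by unfold IsBlack; rw [Int.even_iff]; simp only; omega)
      have ha : p = x + 1 ∨ p = x - 1 := by omega
      have hb : q = y + 1 ∨ q = y - 1 := by omega
      have ha' : p' = x + 1 ∨ p' = x - 1 := by omega
      have hb' : q' = y + 1 ∨ q' = y - 1 := by omega
      rcases ha with rfl | rfl <;> rcases hb with rfl | rfl <;> rcases ha' with rfl | rfl <;>
        rcases hb' with rfl | rfl <;> linarith
    · have c0 : c (x, y) = 0 := by
        by_contra h
        exact hf (hΩ' _ h)
      have r := hH x y c0 (by unfold IsBlack; rw [Int.even_iff]; simp only; omega)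
      have hq1 : q = y := by omega
      have hq2 : q' = y := by omega
      subst hq1 hq2
      have ha : p = x + 1 ∨ p = x - 1 := by omega
      have ha' : p' = x + 1 ∨ p' = x - 1 := by omega
      rcases ha with rfl | rfl <;> rcases ha' with rfl | rfl <;> linarith
    · have c0 : c (x, y) = 0 := by
        by_contra h
        exact hf (hΩ' _ h)
      have r := hV x y (by omega) c0 hy
      have hq1 : p = x := by omega
      have hq2 : p' = x := by omega
      subst hq1 hq2
      have ha : q = y + 1 ∨ q = y - 1 := by omega
      have ha' : q' = y + 1 ∨ q' = y - 1 := by omega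
      rcases ha with rfl | rfl <;> rcases ha' with rfl | rfl <;> linarith
    · have e1 : p = x := by omega
      have e2 : p' = x := by omega
      have e3 : q = y := by omega
      have e4 : q' = y := by omega
      rw [e1, e2, e3, e4]
  -- Adjacent squares have a common nearby square of class `k + 1`, through which the constant
  -- passes on.
  have hcommon : ∀ f f', faceGraph.Adj f f' → ∃ g, IsClass (k + 1) g ∧ |g.1 - f.1| ≤ 1 ∧
      |g.2 - f.2| ≤ 1 ∧ |g.1 - f'.1| ≤ 1 ∧ |g.2 - f'.2| ≤ 1 := by
    rintro ⟨x, y⟩ ⟨x', y'⟩ h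
    have hpar : ∀ a b : ℤ, |a - b| ≤ 1 → ∃ p, Even (p - (k + 1)) ∧ |p - a| ≤ 1 ∧ |p - b| ≤ 1 := by
      intro a b hab
      simp only [abs_le, Int.even_iff] at *
      by_cases h1 : (a - (k + 1)) % 2 = 0
      · exact ⟨a, h1, by omega⟩
      · by_cases h2 : a = b
        · exact ⟨a + 1, by omega⟩
        · exact ⟨b, by omega⟩
    have hx : |x - x'| ≤ 1 := by
      rw [abs_le]; simp only [faceGraph] at h; omega
    have hy : |y - y'| ≤ 1 := by
      rw [abs_le]; simp only [faceGraph] at h; omega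
    obtain ⟨p, p1, p2, p3⟩ := hpar x x' hx
    obtain ⟨q, q1, q2, q3⟩ := hpar y y' hy
    exact ⟨(p, q), ⟨p1, q1⟩, p2, q2, p3, q3⟩
  obtain ⟨N, hN⟩ := exists_bound Ω
  have hf₀ : ((N + 1, 0) : Face) ∉ Ω := fun h => by
    have := (hN _ h).2.1
    simp only at this
    omega
  -- The walk starts east of `Ω`, where the rays meet no flow. That it reaches every outer square is
  -- the absence of holes.
  have hwalk : ∀ a : {f : Face | f ∉ Ω},
      Relation.ReflTransGen (faceGraph.induce {f : Face | f ∉ Ω}).Adj ⟨(N + 1, 0), hf₀⟩ a →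
      ∀ g, IsClass (k + 1) g → |g.1 - a.1.1| ≤ 1 → |g.2 - a.1.2| ≤ 1 → rayFlow Ω c g = 0 := by
    intro a ha
    induction ha with
    | refl =>
      intro g _ h1 _
      by_contra h
      obtain ⟨w, hw, hlt⟩ := exists_of_rayFlow_ne_zero h
      have := (hN _ (hΩ' w hw)).2.1
      rw [abs_le] at h1
      simp only at h1
      omega
    | tail _ hab ih =>
      rename_i a b _
      intro g hg h1 h2
      obtain ⟨g', hg', b1, b2, b3, b4⟩ := hcommon _ _ (SimpleGraph.comap_adj.mp hab)
      rw [hconst b.1 b.2 g g' hg hg' h1 h2 b3 b4]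
      exact ih g' hg' b1 b2
  exact hwalk ⟨f, hf⟩ ((SimpleGraph.reachable_iff_reflTransGen _ _).mp (hconn.preconnected _ _))
    g hg h1 h2

/-- The four white neighbours of a square, sorted by their position along the axis. -/
theorem indicator_neighbours {b w : Face} (hb : IsClass k b) (hw : ¬ IsBlack w) :
    (if w = (b.1 + 1, b.2) then (1 : ℝ) else 0) +
        (if w = (b.1, b.2 + 1) then 1 else 0) - (if w = (b.1 - 1, b.2) then 1 else 0) -
        (if w = (b.1, b.2 - 1) then 1 else 0) =
        -((if b = w + axis k w then 1 else 0) - (if b = w - axis k w then 1 else 0)) := by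
  obtain ⟨x, y⟩ := w
  obtain ⟨p, q⟩ := b
  obtain ⟨hp, hq⟩ := hb
  rcases axis_cases (k := k) hw with ⟨e, -, h1, h2⟩ | ⟨e, -, h1, h2⟩ <;> rw [e] <;>
    simp only [Int.even_iff, Prod.mk_add_mk, Prod.mk_sub_mk, Prod.mk.injEq] at *
  · have n1 : ¬ (x = p + 1 ∧ y = q) := by omega
    have n2 : ¬ (x = p - 1 ∧ y = q) := by omega
    have i1 : (x = p ∧ y = q + 1) ↔ (p = x - 0 ∧ q = y - 1) := by omega
    have i2 : (x = p ∧ y = q - 1) ↔ (p = x + 0 ∧ q = y + 1) := by omega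
    simp only [n1, n2, i1, i2, if_false]
    ring
  · have n1 : ¬ (x = p ∧ y = q + 1) := by omega
    have n2 : ¬ (x = p ∧ y = q - 1) := by omega
    have i1 : (x = p + 1 ∧ y = q) ↔ (p = x - 1 ∧ q = y - 0) := by omega
    have i2 : (x = p - 1 ∧ y = q) ↔ (p = x + 1 ∧ q = y + 0) := by omega
    simp only [n1, n2, i1, i2, if_false]
    ring

/-- A finite set of squares of one class that is closed under an injective choice of white
neighbours carries a nonzero divergence-free flow. -/
theorem exists_flow_of_closed {X : Finset Face} (hX : X.Nonempty) (μ : Face → Face)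
    (hinj : ∀ g ∈ X, ∀ g' ∈ X, μ g = μ g' → g = g') (hwhite : ∀ g ∈ X, ¬ IsBlack (μ g))
    (hcl : ∀ g ∈ X, μ g + axis k (μ g) ∈ X ∧ μ g - axis k (μ g) ∈ X) :
    ∃ c : Face → ℝ, (∃ w, c w ≠ 0) ∧ (∀ w, c w ≠ 0 → ∃ g ∈ X, μ g = w) ∧
      ∀ b, IsClass k b → divergence c b = 0 := by
  classical
  let A : Matrix X X ℝ := fun g x =>
    (if x.1 = μ g + axis k (μ g) then 1 else 0) - (if x.1 = μ g - axis k (μ g) then 1 else 0)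
  obtain ⟨g₀, hg₀⟩ := hX
  -- There are as many chosen edges as squares in `X`, and the rows sum to zero because both ends of
  -- each edge lie in `X`. A left kernel vector is the flow.
  have hdet : A.det = 0 := by
    rw [← Matrix.exists_mulVec_eq_zero_iff]
    refine ⟨fun _ => 1, fun h => one_ne_zero (congrFun h ⟨g₀, hg₀⟩), ?_⟩
    ext g
    have e1 : ∀ x : X, (x.1 = μ g + axis k (μ g)) ↔ x = ⟨_, (hcl g g.2).1⟩ := fun x => by
      rw [Subtype.ext_iff]
    have e2 : ∀ x : X, (x.1 = μ g - axis k (μ g)) ↔ x = ⟨_, (hcl g g.2).2⟩ := fun x => by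
      rw [Subtype.ext_iff]
    simp only [Matrix.mulVec, dotProduct, A, mul_one, Finset.sum_sub_distrib, e1, e2,
      Finset.sum_ite_eq', Finset.mem_univ, if_true, Pi.zero_apply, sub_self]
  obtain ⟨v, hv, hvA⟩ := Matrix.exists_vecMul_eq_zero_iff.mpr hdet
  refine ⟨fun w => ∑ g : X, v g * (if μ g = w then 1 else 0), ?_, ?_, ?_⟩
  · obtain ⟨g, hg⟩ := Function.ne_iff.mp hv
    refine ⟨μ g, ?_⟩
    beta_reduce
    rw [Finset.sum_eq_single g]
    · simpa using hg
    · intro g' _ hne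
      rw [if_neg (fun h => hne (Subtype.ext (hinj _ g'.2 _ g.2 h))), mul_zero]
    · simp
  · intro w hw
    obtain ⟨g, -, hg⟩ := Finset.exists_ne_zero_of_sum_ne_zero hw
    refine ⟨g, g.2, ?_⟩
    by_contra h
    simp [h] at hg
  · intro b hb
    have hrow := fun g : X => indicator_neighbours hb (hwhite g g.2)
    have hsum : divergence (fun w => ∑ g : X, v g * (if μ g = w then 1 else 0)) b =
        -∑ g : X, v g * ((if b = μ g + axis k (μ g) then 1 else 0) -
          (if b = μ g - axis k (μ g) then 1 else 0)) := by
      unfold divergence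
      rw [← Finset.sum_add_distrib, ← Finset.sum_sub_distrib, ← Finset.sum_sub_distrib,
        ← Finset.sum_neg_distrib]
      refine Finset.sum_congr rfl fun g _ => ?_
      rw [← mul_neg, ← hrow g]
      ring
    rw [hsum, neg_eq_zero]
    by_cases hbX : b ∈ X
    · have := congrFun hvA ⟨b, hbX⟩
      simpa [Matrix.vecMul, dotProduct, A] using this
    · refine Finset.sum_eq_zero fun g _ => ?_
      have n1 : b ≠ μ g + axis k (μ g) := fun h => hbX (by rw [h]; exact (hcl g g.2).1)
      have n2 : b ≠ μ g - axis k (μ g) := fun h => hbX (by rw [h]; exact (hcl g g.2).2)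
      simp [n1, n2]

/-- The divergence-free flows at the squares of class `k`, on white squares that `μ` assigns to
squares of class `k`. -/
structure IsMatchedFlow (Ω : Finset Face) (u : Face) (μ : Face → Face) (k : ℤ) (c : Face → ℝ) :
    Prop where
  white : ∀ w, c w ≠ 0 → ¬ IsBlack w
  matched : ∀ w, c w ≠ 0 → ∃ b ∈ Ω, b ≠ u ∧ IsClass k b ∧ μ b = w
  mem : ∀ w, c w ≠ 0 → w ∈ Ω ∧ w + axis k w ∈ Ω ∧ w - axis k w ∈ Ω
  divergence_eq : ∀ b, IsClass k b → divergence c b = 0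

/-- A nonzero flow encloses a nonzero flow of the other class. -/
theorem IsMatchedFlow.exists_inner {u f₀ : Face} {μ : Face → Face}
    (hconn : (faceGraph.induce {f : Face | f ∉ Ω}).Connected)
    (huf : faceGraph.Adj u f₀) (hf₀ : f₀ ∉ Ω)
    (hμ : ∀ b ∈ Ω, b ≠ u → IsBlack b → μ b ∈ Ω ∧ ¬ IsBlack (μ b) ∧ faceGraph.Adj b (μ b))
    (hinj : ∀ b ∈ Ω, b ≠ u → IsBlack b → ∀ b' ∈ Ω, b' ≠ u → IsBlack b' → μ b = μ b' → b = b')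
    (hc : IsMatchedFlow Ω u μ k c) (hne : ∃ w, c w ≠ 0) :
    ∃ c', IsMatchedFlow Ω u μ (k + 1) c' ∧ (∃ w, c' w ≠ 0) ∧
      ∀ M, (∀ w, c w ≠ 0 → w.1 ≤ M) → ∀ w, c' w ≠ 0 → w.1 ≤ M - 1 := by
  classical
  have hwhite : ∀ w, IsBlack w → c w = 0 := fun w hb => by
    by_contra h
    exact hc.white w h hb
  have hΩ : ∀ w, c w ≠ 0 → w ∈ Ω := fun w h => (hc.mem w h).1
  have hjump := fun {w : Face} (hw : ¬ IsBlack w) =>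
    rayFlow_jump hΩ hwhite hc.divergence_eq hw
  have hout : ∀ {f : Face}, f ∉ Ω → ∀ {g : Face}, IsClass (k + 1) g → |g.1 - f.1| ≤ 1 →
      |g.2 - f.2| ≤ 1 → rayFlow Ω c g = 0 := fun hf _ hg h1 h2 =>
    rayFlow_outside hconn hwhite hc.mem hc.divergence_eq hf hg h1 h2
  -- A potential that is zero everywhere has no jumps, hence comes from no flow.
  obtain ⟨g₀, hg₀, hα⟩ : ∃ g₀, IsClass (k + 1) g₀ ∧ rayFlow Ω c g₀ ≠ 0 := by
    obtain ⟨w, hw⟩ := hne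
    by_contra! h
    have hb := hc.white w hw
    apply hw
    rw [← hjump hb, h _ (isClass_add_axis hb), h _ (isClass_sub_axis hb)]
  have hmem : ∀ g, IsClass (k + 1) g → rayFlow Ω c g = rayFlow Ω c g₀ → g ∈ Ω ∧ g ≠ u := by
    intro g hg h
    constructor
    · by_contra hn
      exact hα (h ▸ hout hn hg (by simp) (by simp))
    · rintro rfl
      apply hα
      rw [← h]
      refine hout hf₀ hg ?_ ?_ <;> rw [abs_le] <;> simp only [faceGraph] at huf <;> omega
  -- A level set with nonzero value avoids the outside and also `u`, which touches the outside.
  set X : Finset Face :=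
    Ω.filter fun g => IsClass (k + 1) g ∧ rayFlow Ω c g = rayFlow Ω c g₀ with hXdef
  have hX : ∀ g, g ∈ X ↔ IsClass (k + 1) g ∧ rayFlow Ω c g = rayFlow Ω c g₀ := by
    intro g
    rw [hXdef, Finset.mem_filter]
    exact ⟨fun h => h.2, fun h => ⟨(hmem g h.1 h.2).1, h⟩⟩
  have hμX : ∀ g ∈ X, μ g ∈ Ω ∧ ¬ IsBlack (μ g) ∧ faceGraph.Adj g (μ g) := by
    intro g hg
    obtain ⟨h1, h2⟩ := (hX g).mp hg
    obtain ⟨h3, h4⟩ := hmem g h1 h2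
    exact hμ g h3 h4 h1.isBlack
  have hcl : ∀ g ∈ X, μ g + axis (k + 1) (μ g) ∈ X ∧ μ g - axis (k + 1) (μ g) ∈ X := by
    intro g hg
    obtain ⟨h1, h2⟩ := (hX g).mp hg
    obtain ⟨h3, h4⟩ := hmem g h1 h2
    obtain ⟨-, hw, hadj⟩ := hμX g hg
    -- `c` lives on white squares assigned to class `k`, and `μ g` is assigned to class `k + 1`; so
    -- the potential does not jump across `μ g` and both its ends stay in `X`.
    have h0 : c (μ g) = 0 := by
      by_contra h
      obtain ⟨b, hb, hbu, hbk, hbμ⟩ := hc.matched _ h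
      have := hinj b hb hbu hbk.isBlack g h3 h4 h1.isBlack hbμ
      exact hbk.not_succ (this ▸ h1)
    have heq := (hjump hw).mpr h0
    rw [hX, hX]
    refine ⟨⟨isClass_add_axis hw, ?_⟩, ⟨isClass_sub_axis hw, ?_⟩⟩
    · rcases eq_axis_of_adj hw h1 hadj with e | e
      · rw [← e, h2]
      · rw [heq, ← e, h2]
    · rcases eq_axis_of_adj hw h1 hadj with e | e
      · rw [← heq, ← e, h2]
      · rw [← e, h2]
  obtain ⟨c', hne', hsupp, hdiv'⟩ := exists_flow_of_closed (k := k + 1)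
    ⟨g₀, (hX g₀).mpr ⟨hg₀, rfl⟩⟩ μ (by
      intro g hg g' hg' h
      obtain ⟨h1, h2⟩ := (hX g).mp hg
      obtain ⟨h3, h4⟩ := hmem g h1 h2
      obtain ⟨h1', h2'⟩ := (hX g').mp hg'
      obtain ⟨h3', h4'⟩ := hmem g' h1' h2'
      exact hinj g h3 h4 h1.isBlack g' h3' h4' h1'.isBlack h) (fun g hg => (hμX g hg).2.1) hcl
  refine ⟨c', ⟨?_, ?_, ?_, hdiv'⟩, hne', ?_⟩
  · intro w hw
    obtain ⟨g, hg, rfl⟩ := hsupp w hw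
    exact (hμX g hg).2.1
  · intro w hw
    obtain ⟨g, hg, rfl⟩ := hsupp w hw
    obtain ⟨h1, h2⟩ := (hX g).mp hg
    obtain ⟨h3, h4⟩ := hmem g h1 h2
    exact ⟨g, h3, h4, h1, rfl⟩
  · intro w hw
    obtain ⟨g, hg, rfl⟩ := hsupp w hw
    have h1 := (hX _).mp (hcl g hg).1
    have h2 := (hX _).mp (hcl g hg).2
    exact ⟨(hμX g hg).1, (hmem _ h1.1 h1.2).1, (hmem _ h2.1 h2.2).1⟩
  · intro M hM w hw
    obtain ⟨g, hg, rfl⟩ := hsupp w hw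
    have h1 := (hX _).mp (hcl g hg).1
    -- A nonzero potential at an end of `μ g` requires flow of `c` strictly to the east.
    obtain ⟨w', hw', hlt⟩ := exists_of_rayFlow_ne_zero (Ω := Ω) (c := c)
      (g := μ g + axis (k + 1) (μ g)) (by rw [h1.2]; exact hα)
    have h2 := hM w' hw'
    have h3 : 0 ≤ (axis (k + 1) (μ g)).1 := by
      unfold axis
      split_ifs <;> simp
    rw [Prod.fst_add] at hlt
    omega

/-- Infinite descent: each inner flow, of the other class, loses at least one column in the east,
while all supports lie in the bounded domain. -/
theorem IsMatchedFlow.eq_zero {u f₀ : Face} {μ : Face → Face}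
    (hconn : (faceGraph.induce {f : Face | f ∉ Ω}).Connected)
    (huf : faceGraph.Adj u f₀) (hf₀ : f₀ ∉ Ω)
    (hμ : ∀ b ∈ Ω, b ≠ u → IsBlack b → μ b ∈ Ω ∧ ¬ IsBlack (μ b) ∧ faceGraph.Adj b (μ b))
    (hinj : ∀ b ∈ Ω, b ≠ u → IsBlack b → ∀ b' ∈ Ω, b' ≠ u → IsBlack b' → μ b = μ b' → b = b')
    (hc : IsMatchedFlow Ω u μ k c) (w : Face) : c w = 0 := by
  obtain ⟨N, hN⟩ := exists_bound Ω
  -- `n` bounds the number of columns open to the flow; for `n = 0` the bound `-N - 1` is already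
  -- west of `Ω`.
  have key : ∀ n : ℕ, ∀ k c, IsMatchedFlow Ω u μ k c → (∀ w, c w ≠ 0 → w.1 ≤ n - N - 1) →
      ∀ w, c w = 0 := by
    intro n
    induction n with
    | zero =>
      intro k c hc hM w
      by_contra h
      have h1 := hM w h
      have h2 := (hN w (hc.mem w h).1).1
      push_cast at h1
      omega
    | succ n ih =>
      intro k c hc hM w
      by_contra h
      obtain ⟨c', hc', ⟨w', hw'⟩, hM'⟩ := hc.exists_inner hconn huf hf₀ hμ hinj ⟨w, h⟩
      refine hw' (ih (k + 1) c' hc' (fun x hx => ?_) w')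
      have := hM' _ hM x hx
      push_cast at this
      omega
  refine key (2 * N + 1).toNat k c hc (fun w hw => ?_) w
  have h1 := (hN w (hc.mem w hw).1).2.1
  have h2 := Int.self_le_toNat (2 * N + 1)
  omega

end Flow

/-! ### The graph of an odd Temperley domain -/

section Domain

instance (k : ℤ) : DecidablePred (IsClass k) := fun f =>
  inferInstanceAs (Decidable (Even (f.1 - k) ∧ Even (f.2 - k)))

noncomputable instance (Ω : Finset Face) (p : Face → Prop) [DecidablePred p] :
    Fintype {f // f ∈ Ω ∧ p f} :=
  Fintype.subtype (Ω.filter p) (by simp)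

/-- The white squares of a domain. -/
abbrev WhiteSquare (Ω : Finset Face) : Type := {f : Face // f ∈ Ω ∧ ¬ IsBlack f}

/-- The squares of a domain in a class. -/
abbrev ClassSquare (Ω : Finset Face) (k : ℤ) : Type := {f : Face // f ∈ Ω ∧ IsClass k f}

variable {Ω : Finset Face}

/-- The extension by zero of a function on the white squares. -/
noncomputable def extendZero (c : WhiteSquare Ω → ℝ) (f : Face) : ℝ :=
  if h : f ∈ Ω ∧ ¬ IsBlack f then c ⟨f, h⟩ else 0

theorem extendZero_coe (c : WhiteSquare Ω → ℝ) (w : WhiteSquare Ω) : extendZero c w = c w :=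
  dif_pos w.2

theorem mem_of_extendZero {c : WhiteSquare Ω → ℝ} {f : Face} (h : extendZero c f ≠ 0) :
    f ∈ Ω ∧ ¬ IsBlack f := by
  by_contra hn
  exact h (dif_neg hn)

theorem sum_mul_indicator (c : WhiteSquare Ω → ℝ) (f : Face) :
    ∑ w : WhiteSquare Ω, c w * (if w.1 = f then 1 else 0) = extendZero c f := by
  by_cases h : f ∈ Ω ∧ ¬ IsBlack f
  · rw [Finset.sum_eq_single ⟨f, h⟩]
    · simp [extendZero, h]
    · intro w _ hne
      rw [if_neg (fun h' => hne (Subtype.ext h')), mul_zero]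
    · simp
  · rw [extendZero, dif_neg h]
    refine Finset.sum_eq_zero fun w _ => ?_
    rw [if_neg (by rintro rfl; exact h w.2), mul_zero]

/-- The sign arises because incidences count inflow and `divergence` counts outflow. -/
theorem sum_mul_axis {k : ℤ} (c : WhiteSquare Ω → ℝ) {b : Face} (hb : IsClass k b) :
    ∑ w : WhiteSquare Ω, c w * ((if b = w + axis k w then 1 else 0) -
      (if b = w - axis k w then 1 else 0)) = -divergence (extendZero c) b := by
  unfold divergence
  simp_rw [← sum_mul_indicator]
  rw [← Finset.sum_add_distrib, ← Finset.sum_sub_distrib, ← Finset.sum_sub_distrib,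
    ← Finset.sum_neg_distrib]
  refine Finset.sum_congr rfl fun w _ => ?_
  have := indicator_neighbours hb w.2.2
  rw [← neg_eq_iff_eq_neg] at this
  rw [← this]
  ring

/-- The end of an edge of the graph of the squares of class `0`. -/
def edgeHead (hΩ : IsOddTemperley Ω) (w : WhiteSquare Ω) : ClassSquare Ω 0 :=
  ⟨w + axis 0 w, (hΩ.axis_mem w.2.1 w.2.2).1, isClass_add_axis w.2.2⟩

/-- The beginning of an edge of the graph of the squares of class `0`. -/
def edgeTail (hΩ : IsOddTemperley Ω) (w : WhiteSquare Ω) : ClassSquare Ω 0 :=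
  ⟨w - axis 0 w, (hΩ.axis_mem w.2.1 w.2.2).2, isClass_sub_axis w.2.2⟩

/-- The curl matrix, for counterclockwise circulations around the squares of class `1`. -/
noncomputable def curlMatrix (w : WhiteSquare Ω) (b : ClassSquare Ω 1) : ℝ :=
  -- In an even column the edge points north and is counterclockwise around the square to its west;
  -- otherwise it points east and is counterclockwise around the square to its north.
  (if Even w.1.1 then -1 else 1) *
    ((if b.1 = w + axis 1 w then 1 else 0) - (if b.1 = w - axis 1 w then 1 else 0))

theorem add_axis_ne_sub_axis (k : ℤ) (w : Face) : w + axis k w ≠ w - axis k w := by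
  obtain ⟨x, y⟩ := w
  unfold axis
  split_ifs <;> simp only [Prod.mk_add_mk, Prod.mk_sub_mk, ne_eq, Prod.mk.injEq] <;> omega

theorem edgeHead_ne_edgeTail (hΩ : IsOddTemperley Ω) (w : WhiteSquare Ω) :
    edgeHead hΩ w ≠ edgeTail hΩ w := fun h =>
  add_axis_ne_sub_axis 0 w.1 (congrArg Subtype.val h)

theorem incidence_edge (hΩ : IsOddTemperley Ω) (w : WhiteSquare Ω) (v : ClassSquare Ω 0) :
    incidence (edgeHead hΩ) (edgeTail hΩ) w v =
      (if v.1 = w + axis 0 w then 1 else 0) - (if v.1 = w - axis 0 w then 1 else 0) := by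
  simp [incidence, edgeHead, edgeTail, Subtype.ext_iff]

theorem curlMatrix_ne_zero (w : WhiteSquare Ω) (b : ClassSquare Ω 1) :
    curlMatrix w b ≠ 0 ↔ b.1 = w + axis 1 w ∨ b.1 = w - axis 1 w := by
  have := add_axis_ne_sub_axis 1 w.1
  have h0 : (if Even w.1.1 then (-1 : ℝ) else 1) ≠ 0 := by split_ifs <;> norm_num
  rw [curlMatrix, mul_ne_zero_iff_left h0]
  by_cases h1 : b.1 = w + axis 1 w
  · simp [h1, this]
  · by_cases h2 : b.1 = w - axis 1 w <;> simp [h1, h2, this.symm]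

theorem curlMatrix_opposite (w : WhiteSquare Ω) (x y : ClassSquare Ω 1) (hxy : x ≠ y)
    (hx : curlMatrix w x ≠ 0) (hy : curlMatrix w y ≠ 0) : curlMatrix w x + curlMatrix w y = 0 := by
  have := add_axis_ne_sub_axis 1 w.1
  rw [curlMatrix_ne_zero] at hx hy
  have hxy' : x.1 ≠ y.1 := fun h => hxy (Subtype.ext h)
  unfold curlMatrix
  rcases hx with hx | hx <;> rcases hy with hy | hy
  · exact absurd (hx.trans hy.symm) hxy'
  · simp [hx, hy, this, this.symm]
  · simp [hx, hy, this, this.symm]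
  · exact absurd (hx.trans hy.symm) hxy'

/-- All four edges around a face belong to the domain, so no term is lost at the boundary. -/
theorem sum_curlMatrix_mul (hΩ : IsOddTemperley Ω) (b : ClassSquare Ω 1) (f : Face → ℝ) :
    ∑ w, curlMatrix w b * f w.1 = f (b.1.1, b.1.2 - 1) + f (b.1.1 + 1, b.1.2) -
      f (b.1.1, b.1.2 + 1) - f (b.1.1 - 1, b.1.2) := by
  have h := sum_mul_axis (fun w : WhiteSquare Ω => (if Even w.1.1 then -1 else 1) * f w.1) b.2.2
  have h1 : ∀ w : WhiteSquare Ω, curlMatrix w b * f w.1 =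
      (if Even w.1.1 then -1 else 1) * f w.1 * ((if b.1 = w + axis 1 w then 1 else 0) -
      (if b.1 = w - axis 1 w then 1 else 0)) := fun w => by unfold curlMatrix; ring
  simp_rw [h1]
  rw [h]
  obtain ⟨⟨x, y⟩, hb, hc⟩ := b
  have hmem := fun g => hΩ.adj_mem hb hc (f := g)
  obtain ⟨hx, hy⟩ := hc
  have m1 := hmem (x + 1, y) (by simp [faceGraph])
  have m2 := hmem (x - 1, y) (by simp [faceGraph])
  have m3 := hmem (x, y + 1) (by simp [faceGraph])
  have m4 := hmem (x, y - 1) (by simp [faceGraph])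
  simp only [Int.even_iff] at hx hy
  have w1 : ¬ IsBlack (x + 1, y) := by unfold IsBlack; rw [Int.even_iff]; simp only; omega
  have w2 : ¬ IsBlack (x - 1, y) := by unfold IsBlack; rw [Int.even_iff]; simp only; omega
  have w3 : ¬ IsBlack (x, y + 1) := by unfold IsBlack; rw [Int.even_iff]; simp only; omega
  have w4 : ¬ IsBlack (x, y - 1) := by unfold IsBlack; rw [Int.even_iff]; simp only; omega
  have e0 : ¬ Even x := by rw [Int.even_iff]; omega
  have e1 : Even (x + 1) := by rw [Int.even_iff]; omega
  have e2 : Even (x - 1) := by rw [Int.even_iff]; omega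
  simp only [divergence, extendZero, m1, m2, m3, m4, w1, w2, w3, w4, not_false_eq_true, and_self,
    dif_pos, e0, e1, e2, if_true, if_false]
  ring

/-- A circulation enters each corner of its face once and leaves it once. -/
theorem sum_curlMatrix_mul_incidence (hΩ : IsOddTemperley Ω) (b : ClassSquare Ω 1)
    (v : ClassSquare Ω 0) :
    ∑ w, curlMatrix w b * incidence (edgeHead hΩ) (edgeTail hΩ) w v = 0 := by
  simp_rw [incidence_edge]
  rw [sum_curlMatrix_mul hΩ b (fun w => (if v.1 = w + axis 0 w then 1 else 0) -
    (if v.1 = w - axis 0 w then 1 else 0))]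
  obtain ⟨⟨x, y⟩, -, hx, hy⟩ := b
  simp only [Int.even_iff] at hx hy
  have e0 : ¬ Even x := by rw [Int.even_iff]; omega
  have e1 : Even (x + 1) := by rw [Int.even_iff]; omega
  have e2 : Even (x - 1) := by rw [Int.even_iff]; omega
  simp only [axis, sub_zero, e0, e1, e2, if_true, if_false, Prod.mk_add_mk, Prod.mk_sub_mk, add_zero]
  ring

/-- The hypothesis says that `a`, extended by zero, does not jump across white squares. Moving east
in steps of two it keeps its value until it leaves `Ω`, where it is zero. -/
theorem curlMatrix_injective (hΩ : IsOddTemperley Ω) (a : ClassSquare Ω 1 → ℝ)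
    (ha : ∀ w : WhiteSquare Ω, ∑ b, curlMatrix w b * a b = 0) : a = 0 := by
  set A : Face → ℝ := fun f => if h : f ∈ Ω ∧ IsClass 1 f then a ⟨f, h⟩ else 0 with hA
  have hsum : ∀ f : Face, ∑ b : ClassSquare Ω 1, (if b.1 = f then (1 : ℝ) else 0) * a b = A f := by
    intro f
    by_cases h : f ∈ Ω ∧ IsClass 1 f
    · rw [Finset.sum_eq_single ⟨f, h⟩]
      · simp [hA, h]
      · intro w _ hne
        rw [if_neg (fun h' => hne (Subtype.ext h')), zero_mul]
      · simp
    · rw [hA]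
      simp only [dif_neg h]
      refine Finset.sum_eq_zero fun w _ => ?_
      rw [if_neg (by rintro rfl; exact h w.2), zero_mul]
  have hjump : ∀ w : WhiteSquare Ω, A (w + axis 1 w) = A (w - axis 1 w) := by
    intro w
    have h := ha w
    simp only [curlMatrix, mul_assoc, sub_mul, ← Finset.mul_sum, Finset.sum_sub_distrib, hsum] at h
    have h0 : (if Even w.1.1 then (-1 : ℝ) else 1) ≠ 0 := by split_ifs <;> norm_num
    exact sub_eq_zero.mp ((mul_eq_zero.mp h).resolve_left h0)
  obtain ⟨N, hN⟩ := exists_bound Ω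
  have key : ∀ n : ℕ, ∀ x y : ℤ, IsClass 1 (x, y) → N < x + 2 * n → A (x, y) = 0 := by
    intro n
    induction n with
    | zero =>
      intro x y _ h
      rw [hA]
      refine dif_neg fun h' => ?_
      have := (hN _ h'.1).2.1
      simp only at this
      push_cast at h
      omega
    | succ n ih =>
      intro x y hc h
      by_cases hb : (x, y) ∈ Ω
      · have hw : (x + 1, y) ∈ Ω := hΩ.adj_mem hb hc (by simp [faceGraph])
        obtain ⟨h1, h2⟩ := hc
        simp only [Int.even_iff] at h1 h2
        have hj := hjump ⟨(x + 1, y), hw, by unfold IsBlack; rw [Int.even_iff]; simp only; omega⟩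
        have e : axis 1 (x + 1, y) = (1, 0) := by
          unfold axis
          rw [if_neg (by rw [Int.even_iff]; simp only; omega)]
        simp only [e, Prod.mk_add_mk, Prod.mk_sub_mk, add_sub_cancel_right, add_zero, sub_zero] at hj
        rw [← hj]
        refine ih _ _ ?_ ?_
        · constructor <;> simp only [Int.even_iff] <;> omega
        · push_cast at h
          omega
      · exact dif_neg fun h' => hb h'.1
  ext b
  have h2 := Int.self_le_toNat (N - b.1.1 + 1)
  have := key (N - b.1.1 + 1).toNat b.1.1 b.1.2 b.2.2 (by
    have := Int.natCast_nonneg (N - b.1.1 + 1).toNat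
    omega)
  simpa [hA, b.2] using this

/-- The black square of the domain that is a vertex or a face of the graph. -/
def toFace (x : ClassSquare Ω 0 ⊕ ClassSquare Ω 1) : Face := Sum.elim Subtype.val Subtype.val x

theorem toFace_mem (x : ClassSquare Ω 0 ⊕ ClassSquare Ω 1) : toFace x ∈ Ω := by
  rcases x with x | x <;> exact x.2.1

theorem toFace_isBlack (x : ClassSquare Ω 0 ⊕ ClassSquare Ω 1) : IsBlack (toFace x) := by
  rcases x with x | x <;> exact x.2.2.isBlack

theorem toFace_injective : Function.Injective (toFace (Ω := Ω)) := by
  rintro (x | x) (y | y) h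
  · exact congrArg Sum.inl (Subtype.ext h)
  · have h : x.1 = y.1 := h
    exact absurd (h ▸ y.2.2) x.2.2.not_succ
  · have h : x.1 = y.1 := h
    exact absurd (h ▸ x.2.2) y.2.2.not_succ
  · exact congrArg Sum.inr (Subtype.ext h)

theorem exists_toFace {b : Face} (h : b ∈ Ω) (hb : IsBlack b) :
    ∃ x : ClassSquare Ω 0 ⊕ ClassSquare Ω 1, toFace x = b := by
  rcases hb.isClass with hc | hc
  · exact ⟨Sum.inl ⟨b, h, hc⟩, rfl⟩
  · exact ⟨Sum.inr ⟨b, h, hc⟩, rfl⟩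

theorem adj_axis {k : ℤ} {w b : Face} (h : b = w + axis k w ∨ b = w - axis k w) :
    faceGraph.Adj b w := by
  obtain ⟨x, y⟩ := w
  unfold axis at h
  split_ifs at h <;> rcases h with rfl | rfl <;> simp [faceGraph]

/-- A perfect matching of the domain without the class `0` square `u`. -/
abbrev IsDimerMatching (hΩ : IsOddTemperley Ω) (u : ClassSquare Ω 0)
    (m : WhiteSquare Ω → ClassSquare Ω 0 ⊕ ClassSquare Ω 1) : Prop :=
  IsRootedMatching (edgeHead hΩ) (edgeTail hΩ) curlMatrix u m

theorem IsRootedMatching.adj {hΩ : IsOddTemperley Ω} {u : ClassSquare Ω 0}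
    {m : WhiteSquare Ω → ClassSquare Ω 0 ⊕ ClassSquare Ω 1} (hm : IsDimerMatching hΩ u m)
    (w : WhiteSquare Ω) : faceGraph.Adj (toFace (m w)) w := by
  rcases h : m w with v | b
  · refine adj_axis (k := 0) ?_
    rcases hm.primal w v h with rfl | rfl
    · exact Or.inl rfl
    · exact Or.inr rfl
  · exact adj_axis (k := 1) ((curlMatrix_ne_zero w b).mp (hm.dual w b h))

/-- In a domain without holes, the edges matched with vertices form no cycle. -/
theorem IsRootedMatching.isAcyclic {hΩ : IsOddTemperley Ω} {u : ClassSquare Ω 0}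
    (hu : IsBoundaryBlack Ω u)
    {m : WhiteSquare Ω → ClassSquare Ω 0 ⊕ ClassSquare Ω 1} (hm : IsDimerMatching hΩ u m) :
    IsAcyclicEdgeSet (edgeHead hΩ) (edgeTail hΩ) (primalEdges m) := by
  intro c hc hdiv
  obtain ⟨-, -, f₀, huf, hf₀⟩ := hu
  -- `μ` inverts the matching: it sends a black square to its white partner, and its other values do
  -- not matter.
  have hex : ∀ b : Face, ∃ f : Face, b ∈ Ω → b ≠ u → IsBlack b →
      ∃ w : WhiteSquare Ω, w.1 = f ∧ toFace (m w) = b := by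
    intro b
    by_cases h : b ∈ Ω ∧ b ≠ u ∧ IsBlack b
    · obtain ⟨x, rfl⟩ := exists_toFace h.1 h.2.2
      obtain ⟨w, rfl⟩ := hm.covers x (by rintro rfl; exact h.2.1 rfl)
      exact ⟨w, fun _ _ _ => ⟨w, rfl, rfl⟩⟩
    · exact ⟨b, fun h1 h2 h3 => absurd ⟨h1, h2, h3⟩ h⟩
  choose μ hμ using hex
  have hμm : ∀ w, μ (toFace (m w)) = w.1 := by
    intro w
    obtain ⟨w', h1, h2⟩ := hμ (toFace (m w)) (toFace_mem _)
      (fun h => hm.avoids w (toFace_injective (h.trans rfl))) (toFace_isBlack _)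
    rw [← h1, hm.injective (toFace_injective h2)]
  have hflow : IsMatchedFlow Ω u μ 0 (extendZero c) := by
    refine ⟨fun w hw => (mem_of_extendZero hw).2, ?_, ?_, ?_⟩
    · intro w hw
      have hw' := mem_of_extendZero hw
      have hcw : c ⟨w, hw'⟩ ≠ 0 := by rwa [← extendZero_coe c]
      have hp : (⟨w, hw'⟩ : WhiteSquare Ω) ∈ primalEdges m := by
        by_contra h
        exact hcw (hc _ h)
      obtain ⟨v, hv⟩ := (mem_primalEdges m _).mp hp
      refine ⟨v, v.2.1, ?_, v.2.2, ?_⟩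
      · intro h
        exact hm.avoids _ (hv.trans (congrArg Sum.inl (Subtype.ext h)))
      · have := hμm ⟨w, hw'⟩
        rw [hv] at this
        exact this
    · intro w hw
      have hw' := mem_of_extendZero hw
      exact ⟨hw'.1, hΩ.axis_mem hw'.1 hw'.2⟩
    · intro b hb
      rw [← neg_eq_zero, ← sum_mul_axis c hb]
      by_cases hbΩ : b ∈ Ω
      · have := hdiv ⟨b, hbΩ, hb⟩
        simp_rw [incidence_edge] at this
        exact this
      · refine Finset.sum_eq_zero fun w _ => ?_
        obtain ⟨h1, h2⟩ := hΩ.axis_mem w.2.1 w.2.2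
        have n1 : b ≠ w.1 + axis 0 w.1 := fun h => hbΩ (by rw [h]; exact h1)
        have n2 : b ≠ w.1 - axis 0 w.1 := fun h => hbΩ (by rw [h]; exact h2)
        simp [n1, n2]
  intro w
  rw [← extendZero_coe c]
  refine hflow.eq_zero hΩ.domain.compl_connected huf hf₀ ?_ ?_ w
  · intro b hb hbu hbb
    obtain ⟨w, h1, h2⟩ := hμ b hb hbu hbb
    rw [← h1]
    exact ⟨w.2.1, w.2.2, h2 ▸ hm.adj w⟩
  · intro b hb hbu hbb b' hb' hbu' hbb' h
    obtain ⟨w, h1, h2⟩ := hμ b hb hbu hbb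
    obtain ⟨w', h1', h2'⟩ := hμ b' hb' hbu' hbb'
    have : w = w' := Subtype.ext (h1.trans (h.trans h1'.symm))
    rw [← h2, ← h2', this]

end Domain

/-! ### Domino tilings as matchings, and domino counts -/

section Tiling

variable {Ω : Finset Face}

theorem isBlack_iff_of_adj {f g : Face} (h : faceGraph.Adj f g) : IsBlack f ↔ ¬ IsBlack g := by
  obtain ⟨x, y⟩ := f
  obtain ⟨p, q⟩ := g
  unfold IsBlack
  simp only [faceGraph, Int.even_iff] at *
  omega

theorem mem_tilings {D : Finset Face} {T : Finset (Sym2 Face)} :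
    T ∈ tilings D ↔ (∀ e ∈ T, ∀ f ∈ e, f ∈ D) ∧ (∀ f g, s(f, g) ∈ T → faceGraph.Adj f g) ∧
      ∀ f ∈ D, ∃! e : Sym2 Face, e ∈ T ∧ f ∈ e := by
  simp only [tilings, Finset.mem_filter, Finset.mem_powerset, Finset.subset_iff,
    Finset.mem_sym2_iff]
  refine and_congr Iff.rfl (and_congr ⟨fun h f g hfg => h _ hfg, fun h e => ?_⟩ Iff.rfl)
  induction e with
  | _ f g => exact h f g

open Classical in
/-- The tiling formed by the dominoes of a matching. -/
noncomputable def dominoes (m : WhiteSquare Ω → ClassSquare Ω 0 ⊕ ClassSquare Ω 1) :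
    Finset (Sym2 Face) :=
  Finset.univ.image fun w => s(toFace (m w), w.1)

theorem mem_dominoes {m : WhiteSquare Ω → ClassSquare Ω 0 ⊕ ClassSquare Ω 1} {e : Sym2 Face} :
    e ∈ dominoes m ↔ ∃ w, s(toFace (m w), w.1) = e := by
  simp [dominoes]

theorem domino_mem_dominoes {m : WhiteSquare Ω → ClassSquare Ω 0 ⊕ ClassSquare Ω 1} {b : Face}
    (hb : IsBlack b) {w : WhiteSquare Ω} : s(b, w.1) ∈ dominoes m ↔ toFace (m w) = b := by
  rw [mem_dominoes]
  constructor
  · rintro ⟨w', h⟩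
    rcases Sym2.eq_iff.mp h with ⟨h1, h2⟩ | ⟨h1, h2⟩
    · rw [← Subtype.ext h2, h1]
    · exact absurd (h1 ▸ toFace_isBlack (m w')) w.2.2
  · rintro rfl
    exact ⟨w, rfl⟩

theorem IsRootedMatching.dominoes_mem {hΩ : IsOddTemperley Ω} {u : ClassSquare Ω 0}
    {m : WhiteSquare Ω → ClassSquare Ω 0 ⊕ ClassSquare Ω 1} (hm : IsDimerMatching hΩ u m) :
    dominoes m ∈ tilings (Ω.erase u.1) := by
  have hwu : ∀ w : WhiteSquare Ω, w.1 ≠ u.1 := fun w h => w.2.2 (h ▸ u.2.2.isBlack)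
  rw [mem_tilings]
  refine ⟨?_, ?_, ?_⟩
  · intro e he f hf
    obtain ⟨w, rfl⟩ := mem_dominoes.mp he
    rw [Finset.mem_erase]
    rcases Sym2.mem_iff.mp hf with rfl | rfl
    · exact ⟨fun h => hm.avoids w (toFace_injective (h.trans rfl)), toFace_mem _⟩
    · exact ⟨hwu w, w.2.1⟩
  · intro f g h
    obtain ⟨w, h⟩ := mem_dominoes.mp h
    rcases Sym2.eq_iff.mp h with ⟨rfl, rfl⟩ | ⟨rfl, rfl⟩
    · exact hm.adj w
    · exact (hm.adj w).symm
  · intro f hf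
    obtain ⟨hfu, hf⟩ := Finset.mem_erase.mp hf
    by_cases hb : IsBlack f
    · obtain ⟨x, rfl⟩ := exists_toFace hf hb
      obtain ⟨w, rfl⟩ := hm.covers x (by rintro rfl; exact hfu rfl)
      refine ⟨s(toFace (m w), w.1), ⟨mem_dominoes.mpr ⟨w, rfl⟩, by simp⟩, ?_⟩
      rintro e ⟨he, hmem⟩
      obtain ⟨w', rfl⟩ := mem_dominoes.mp he
      rcases Sym2.mem_iff.mp hmem with h | h
      · rw [hm.injective (toFace_injective h)]
      · exact absurd (h ▸ hb) w'.2.2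
    · refine ⟨s(toFace (m ⟨f, hf, hb⟩), f), ⟨mem_dominoes.mpr ⟨⟨f, hf, hb⟩, rfl⟩, by simp⟩, ?_⟩
      rintro e ⟨he, hmem⟩
      obtain ⟨w', rfl⟩ := mem_dominoes.mp he
      rcases Sym2.mem_iff.mp hmem with h | h
      · exact absurd (toFace_isBlack (m w')) (h ▸ hb)
      · subst h
        rfl

theorem exists_dominoes_eq (hΩ : IsOddTemperley Ω) {u : ClassSquare Ω 0} {T : Finset (Sym2 Face)}
    (hT : T ∈ tilings (Ω.erase u.1)) :
    ∃ m : WhiteSquare Ω → ClassSquare Ω 0 ⊕ ClassSquare Ω 1, IsDimerMatching hΩ u m ∧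
      dominoes m = T := by
  obtain ⟨hD, hadj, hcov⟩ := mem_tilings.mp hT
  have hwu : ∀ w : WhiteSquare Ω, w.1 ≠ u.1 := fun w h => w.2.2 (h ▸ u.2.2.isBlack)
  have hex : ∀ w : WhiteSquare Ω, ∃ x : ClassSquare Ω 0 ⊕ ClassSquare Ω 1,
      s(toFace x, w.1) ∈ T := by
    intro w
    obtain ⟨e, ⟨he, hw⟩, -⟩ := hcov w.1 (Finset.mem_erase.mpr ⟨hwu w, w.2.1⟩)
    obtain ⟨b, rfl⟩ := hw
    have hb : IsBlack b := by
      by_contra h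
      exact w.2.2 ((isBlack_iff_of_adj (hadj _ _ he)).mpr h)
    obtain ⟨x, rfl⟩ := exists_toFace
      (Finset.mem_of_mem_erase (hD _ he b (by simp))) hb
    exact ⟨x, Sym2.eq_swap ▸ he⟩
  choose m hm using hex
  have hne : ∀ w, toFace (m w) ≠ u.1 := fun w =>
    (Finset.mem_erase.mp (hD _ (hm w) (toFace (m w)) (by simp))).1
  refine ⟨m, ⟨?_, ?_, ?_, ?_, ?_⟩, ?_⟩
  · intro w w' h
    obtain ⟨e, -, hu⟩ := hcov (toFace (m w)) (Finset.mem_erase.mpr ⟨hne w, toFace_mem _⟩)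
    have h1 := (hu _ ⟨hm w, by simp⟩).trans (hu _ ⟨hm w', by simp [h]⟩).symm
    rw [h] at h1
    exact Subtype.ext (Sym2.congr_right.mp h1)
  · intro w h
    exact hne w (by rw [h]; rfl)
  · intro x hx
    have hxu : toFace x ≠ u.1 := fun h => hx (toFace_injective (h.trans rfl))
    obtain ⟨e, ⟨he, hxe⟩, -⟩ := hcov (toFace x) (Finset.mem_erase.mpr ⟨hxu, toFace_mem _⟩)
    obtain ⟨f, rfl⟩ := hxe
    have hf := Finset.mem_erase.mp (hD _ he f (by simp))
    have hfw : ¬ IsBlack f := (isBlack_iff_of_adj (hadj _ _ he)).mp (toFace_isBlack x)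
    refine ⟨⟨f, hf.2, hfw⟩, ?_⟩
    obtain ⟨e, -, hu⟩ := hcov f (Finset.mem_erase.mpr hf)
    have h1 := (hu _ ⟨hm ⟨f, hf.2, hfw⟩, by simp⟩).trans (hu _ ⟨he, by simp⟩).symm
    exact toFace_injective (Sym2.congr_left.mp h1)
  · intro w v h
    have h1 := hadj _ _ (hm w)
    rw [h] at h1
    rcases eq_axis_of_adj w.2.2 v.2.2 h1 with h2 | h2
    · exact Or.inl (Subtype.ext h2)
    · exact Or.inr (Subtype.ext h2)
  · intro w b h
    have h1 := hadj _ _ (hm w)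
    rw [h] at h1
    exact (curlMatrix_ne_zero w b).mpr (eq_axis_of_adj w.2.2 b.2.2 h1)
  · ext e
    rw [mem_dominoes]
    constructor
    · rintro ⟨w, rfl⟩
      exact hm w
    · have key : ∀ f g, s(f, g) ∈ T → ¬ IsBlack g → ∃ w, s(toFace (m w), w.1) = s(f, g) := by
        intro f g h hg
        have hg' := Finset.mem_erase.mp (hD _ h g (by simp))
        refine ⟨⟨g, hg'.2, hg⟩, ?_⟩
        obtain ⟨e, -, hu⟩ := hcov g (Finset.mem_erase.mpr hg')
        exact (hu _ ⟨hm ⟨g, hg'.2, hg⟩, by simp⟩).trans (hu _ ⟨h, by simp⟩).symm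
      induction e with
      | _ f g =>
        intro h
        by_cases hg : IsBlack g
        · rw [Sym2.eq_swap] at h ⊢
          refine key g f h ?_
          exact (isBlack_iff_of_adj (hadj _ _ h)).mp hg
        · exact key f g h hg

theorem sum_tilings (hΩ : IsOddTemperley Ω) (u : ClassSquare Ω 0)
    (φ : Finset (Sym2 Face) → ℝ) :
    ∑ T ∈ tilings (Ω.erase u.1), φ T =
      ∑ m ∈ rootedMatchings (edgeHead hΩ) (edgeTail hΩ) curlMatrix u, φ (dominoes m) := by
  refine (Finset.sum_bij (fun m _ => dominoes m) ?_ ?_ ?_ ?_).symm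
  · intro m hm
    exact (mem_rootedMatchings.mp hm).dominoes_mem
  · intro m _ m' _ h
    ext1 w
    have h1 : s(toFace (m w), w.1) ∈ dominoes m' := by
      rw [← h]
      exact mem_dominoes.mpr ⟨w, rfl⟩
    exact (toFace_injective ((domino_mem_dominoes (toFace_isBlack _)).mp h1)).symm
  · intro T hT
    obtain ⟨m, hm, rfl⟩ := exists_dominoes_eq hΩ hT
    exact ⟨m, mem_rootedMatchings.mpr hm, rfl⟩
  · intro m _
    rfl

/-- The number of tilings that contain a domino. -/
noncomputable def dominoCount (D : Finset Face) (e : Sym2 Face) : ℝ :=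
  ∑ T ∈ tilings D, if e ∈ T then 1 else 0

theorem dominoCount_eq_zero {D : Finset Face} {e : Sym2 Face} {f : Face} (hf : f ∈ e)
    (hD : f ∉ D) : dominoCount D e = 0 :=
  Finset.sum_eq_zero fun _ hT => if_neg fun he => hD ((mem_tilings.mp hT).1 _ he _ hf)

/-- The domino counts of the domain without either of two boundary squares agree for the dominoes on
squares of class `1`, and differ by a curl-free flow for the dominoes on squares of class `0`. -/
theorem exists_curl_free_dominoCount (hΩ : IsOddTemperley Ω) {u₁ u₂ : Face}
    (hu₁ : IsBoundaryBlack Ω u₁) (hu₂ : IsBoundaryBlack Ω u₂)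
    (ht₁ : (tilings (Ω.erase u₁)).Nonempty) :
    (tilings (Ω.erase u₁)).card = (tilings (Ω.erase u₂)).card ∧
    ∃ G : Face → ℝ,
      (∀ x y : ℤ, (x, y) ∈ Ω → IsClass 1 (x, y) →
        G (x, y - 1) + G (x + 1, y) - G (x, y + 1) - G (x - 1, y) = 0) ∧
      ∀ b w, IsBlack b → ¬ IsBlack w →
        dominoCount (Ω.erase u₁) s(b, w) - dominoCount (Ω.erase u₂) s(b, w) =
          if IsClass 0 b then ((if b = w + axis 0 w then 1 else 0) -
            (if b = w - axis 0 w then 1 else 0)) * G w else 0 := by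
  set v₁ : ClassSquare Ω 0 := ⟨u₁, hu₁.1, hΩ.boundaryBlack_class hu₁⟩
  set v₂ : ClassSquare Ω 0 := ⟨u₂, hu₂.1, hΩ.boundaryBlack_class hu₂⟩
  -- Euler's relation is read off from one tiling.
  have hcard : Fintype.card (WhiteSquare Ω) + 1 =
      Fintype.card (ClassSquare Ω 0) + Fintype.card (ClassSquare Ω 1) := by
    obtain ⟨T, hT⟩ := ht₁
    obtain ⟨m, hm, -⟩ := exists_dominoes_eq hΩ (u := v₁) hT
    exact hm.card_edges
  obtain ⟨hc, hdual, g, hcurl, hprimal⟩ := exists_curl_free_flow (edgeHead_ne_edgeTail hΩ)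
    curlMatrix_opposite (sum_curlMatrix_mul_incidence hΩ) (curlMatrix_injective hΩ) v₁ v₂ hcard
    (by
      rintro u (rfl | rfl) m hm
      · exact hm.isAcyclic hu₁
      · exact hm.isAcyclic hu₂)
  have hcount : ∀ (u : ClassSquare Ω 0) (w : WhiteSquare Ω) x,
      dominoCount (Ω.erase u.1) s(toFace x, w.1) =
      ∑ m ∈ rootedMatchings (edgeHead hΩ) (edgeTail hΩ) curlMatrix u,
        (if m w = x then (1 : ℝ) else 0) := by
    intro u w x
    rw [dominoCount, sum_tilings hΩ u]
    refine Finset.sum_congr rfl fun m _ => ?_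
    simp only [domino_mem_dominoes (toFace_isBlack x), toFace_injective.eq_iff]
  refine ⟨?_, extendZero g, ?_, ?_⟩
  · have h1 := sum_tilings hΩ v₁ fun _ => 1
    have h2 := sum_tilings hΩ v₂ fun _ => 1
    simp only [Finset.sum_const, nsmul_eq_mul, mul_one] at h1 h2
    rw [hc, ← h2] at h1
    exact_mod_cast h1
  · intro x y hb hcl
    have h := sum_curlMatrix_mul hΩ ⟨(x, y), hb, hcl⟩ (extendZero g)
    simp_rw [extendZero_coe] at h
    rw [hcurl] at h
    exact h.symm
  · intro b w hb hw
    by_cases hwΩ : w ∈ Ω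
    · by_cases hbΩ : b ∈ Ω
      · obtain ⟨x, rfl⟩ := exists_toFace hbΩ hb
        have h1 := hcount v₁ ⟨w, hwΩ, hw⟩ x
        have h2 := hcount v₂ ⟨w, hwΩ, hw⟩ x
        simp only [v₁, v₂] at h1 h2
        rw [h1, h2]
        rcases x with v | f
        · rw [hprimal, incidence_edge, if_pos (show IsClass 0 (toFace (Sum.inl v)) from v.2.2),
            ← extendZero_coe g]
          rfl
        · rw [hdual, sub_self, if_neg]
          intro h0
          exact h0.not_succ f.2.2
      -- A black square outside `Ω` is not a class `0` neighbour of a white square of `Ω`, so both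
      -- sides vanish.
      · obtain ⟨h1, h2⟩ := hΩ.axis_mem hwΩ hw
        rw [dominoCount_eq_zero (f := b) (by simp) (fun h => hbΩ (Finset.mem_of_mem_erase h)),
          dominoCount_eq_zero (f := b) (by simp) (fun h => hbΩ (Finset.mem_of_mem_erase h))]
        have n1 : b ≠ w + axis 0 w := fun h => hbΩ (by rw [h]; exact h1)
        have n2 : b ≠ w - axis 0 w := fun h => hbΩ (by rw [h]; exact h2)
        simp [n1, n2]
    · have hG : extendZero g w = 0 := by
        by_contra h
        exact hwΩ (mem_of_extendZero h).1
      rw [dominoCount_eq_zero (f := w) (by simp) (fun h => hwΩ (Finset.mem_of_mem_erase h)),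
        dominoCount_eq_zero (f := w) (by simp) (fun h => hwΩ (Finset.mem_of_mem_erase h)), hG]
      simp

end Tiling

/-! ### Increments of the expected height -/

theorem heightStep_eq (T : Finset (Sym2 Face)) (l r : Face) :
    heightStep T l r = (if IsBlack l then 1 else -1) * (1 / 4 - if s(l, r) ∈ T then 1 else 0) := by
  unfold heightStep
  split_ifs <;> norm_num

theorem expect_heightStep {D : Finset Face} (hD : (tilings D).Nonempty) (l r : Face) :
    (𝔼 T ∈ tilings D, heightStep T l r) =
      (if IsBlack l then 1 else -1) * (1 / 4 - dominoCount D s(l, r) / (tilings D).card) := by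
  have hN : ((tilings D).card : ℝ) ≠ 0 := by
    exact_mod_cast hD.card_pos.ne'
  rw [Finset.expect_eq_sum_div_card]
  simp_rw [heightStep_eq]
  rw [← Finset.mul_sum, Finset.sum_sub_distrib, Finset.sum_const, nsmul_eq_mul, dominoCount]
  field_simp

/-- The increment of the expected double-dimer height along an edge. -/
theorem expectedHeight_step {D₁ D₂ : Finset Face} (ht₁ : (tilings D₁).Nonempty)
    (ht₂ : (tilings D₂).Nonempty) {z₀ : Vertex} {h₁ h₂ : Finset (Sym2 Face) → Vertex → ℝ}
    (hh₁ : ∀ T ∈ tilings D₁, IsHeightFunction D₁ T z₀ (h₁ T))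
    (hh₂ : ∀ T ∈ tilings D₂, IsHeightFunction D₂ T z₀ (h₂ T))
    (hcard : (tilings D₁).card = (tilings D₂).card) {z : Vertex} {d : Dir}
    (he₁ : IsEdgeOf D₁ z d) (he₂ : IsEdgeOf D₂ z d) :
    expectedHeight D₁ D₂ h₁ h₂ (z + d.vec) - expectedHeight D₁ D₂ h₁ h₂ z =
      (if IsBlack (leftFace z d) then -1 else 1) *
        (dominoCount D₁ s(leftFace z d, rightFace z d) -
          dominoCount D₂ s(leftFace z d, rightFace z d)) / (tilings D₁).card := by
  unfold expectedHeight
  rw [← Finset.expect_sub_distrib]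
  have hstep : ∀ p ∈ tilings D₁ ×ˢ tilings D₂,
      h₁ p.1 (z + d.vec) - h₂ p.2 (z + d.vec) - (h₁ p.1 z - h₂ p.2 z) =
        heightStep p.1 (leftFace z d) (rightFace z d) -
          heightStep p.2 (leftFace z d) (rightFace z d) := by
    intro p hp
    obtain ⟨hp₁, hp₂⟩ := Finset.mem_product.mp hp
    rw [← (hh₁ _ hp₁).step z d he₁, ← (hh₂ _ hp₂).step z d he₂]
    ring
  rw [Finset.expect_congr rfl hstep, Finset.expect_product]
  simp_rw [Finset.expect_sub_distrib]
  rw [Finset.expect_const ht₁]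
  simp_rw [Finset.expect_const ht₂]
  -- The terms `1/4` cancel, and the equal numbers of tilings give a common denominator.
  rw [expect_heightStep ht₁, expect_heightStep ht₂, ← hcard]
  split_ifs <;> ring

section Edge

variable {Ω : Finset Face} {z : Vertex}

theorem leftFace_ne_rightFace (z : Vertex) (d : Dir) : leftFace z d ≠ rightFace z d := by
  cases d <;> simp only [leftFace, rightFace, ne_eq, Prod.mk.injEq] <;> omega

theorem IsInteriorVertex.left_mem (hz : IsInteriorVertex Ω z) (d : Dir) : leftFace z d ∈ Ω := by
  cases d <;> exact hz _ (by simp [facesAt, leftFace])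

theorem IsInteriorVertex.right_mem (hz : IsInteriorVertex Ω z) (d : Dir) : rightFace z d ∈ Ω := by
  cases d <;> exact hz _ (by simp [facesAt, rightFace])

theorem IsInteriorVertex.isEdgeOf_erase (hz : IsInteriorVertex Ω z) (u : Face) (d : Dir) :
    IsEdgeOf (Ω.erase u) z d := by
  by_cases h : leftFace z d = u
  · exact Or.inr (Finset.mem_erase.mpr
      ⟨fun h' => leftFace_ne_rightFace z d (h.trans h'.symm), hz.right_mem d⟩)
  · exact Or.inl (Finset.mem_erase.mpr ⟨h, hz.left_mem d⟩)

/-- Next to an interior vertex, removing a boundary square removes no edge. -/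
theorem IsInteriorVertex.isEdgeOf_erase_next (hΩ : IsOddTemperley Ω) (hz : IsInteriorVertex Ω z)
    {u : Face} (hu : IsClass 0 u) {d : Dir} (he : IsEdgeOf Ω (z + d.vec) d) :
    IsEdgeOf (Ω.erase u) (z + d.vec) d := by
  have hl := hz.left_mem d
  have hr := hz.right_mem d
  -- The square at `z` diagonal to `u` has class `1`, so its neighbour across the edge from `u` is
  -- in `Ω` and keeps the edge.
  have hcl : leftFace (z + d.vec) d = u → rightFace (z + d.vec) d ∈ Ω := by
    rintro rfl
    refine hΩ.adj_mem hr ?_ ?_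
    · cases d <;> simp only [IsClass, leftFace, rightFace, Dir.vec, Prod.fst_add, Prod.snd_add,
        Int.even_iff] at * <;> omega
    · cases d <;> simp only [faceGraph, rightFace, Dir.vec, Prod.fst_add, Prod.snd_add, or_true,
        and_true] <;> omega
  have hcr : rightFace (z + d.vec) d = u → leftFace (z + d.vec) d ∈ Ω := by
    rintro rfl
    refine hΩ.adj_mem hl ?_ ?_
    · cases d <;> simp only [IsClass, leftFace, rightFace, Dir.vec, Prod.fst_add, Prod.snd_add,
        Int.even_iff] at * <;> omega
    · cases d <;> simp only [faceGraph, leftFace, Dir.vec, Prod.fst_add, Prod.snd_add, or_true,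
        and_true] <;> omega
  have hne := leftFace_ne_rightFace (z + d.vec) d
  by_cases h1 : leftFace (z + d.vec) d = u
  · exact Or.inr (Finset.mem_erase.mpr ⟨fun h => hne (h1.trans h.symm), hcl h1⟩)
  · by_cases h2 : rightFace (z + d.vec) d = u
    · exact Or.inl (Finset.mem_erase.mpr ⟨h1, hcr h2⟩)
    · exact he.imp (fun h => Finset.mem_erase.mpr ⟨h1, h⟩) fun h => Finset.mem_erase.mpr ⟨h2, h⟩

end Edge

/-- Domino weights that come from a function on the white squares, the weights on the squares of class
`1` being zero, give increments along the edges that alternate along each lattice line. -/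
theorem edge_increments (δ : Sym2 Face → ℝ) (G : Face → ℝ)
    (hδ : ∀ b w, IsBlack b → ¬ IsBlack w → δ s(b, w) =
      if IsClass 0 b then ((if b = w + axis 0 w then 1 else 0) -
        (if b = w - axis 0 w then 1 else 0)) * G w else 0) (z : Vertex) (d : Dir) :
    (if IsBlack (leftFace z d) then -1 else 1) * δ s(leftFace z d, rightFace z d) =
      (if d = .east ∨ d = .south then -1 else 1) *
        ((if (leftFace z d).1 % 2 = 0 ∧ (leftFace z d).2 % 2 = 0 then G (rightFace z d) else 0) +
          (if (rightFace z d).1 % 2 = 0 ∧ (rightFace z d).2 % 2 = 0 then G (leftFace z d)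
            else 0)) := by
  have hcl : ∀ f : Face, IsClass 0 f ↔ f.1 % 2 = 0 ∧ f.2 % 2 = 0 := by
    intro f
    simp [IsClass, Int.even_iff]
  have hadj : faceGraph.Adj (leftFace z d) (rightFace z d) := by
    cases d <;> simp [faceGraph, leftFace, rightFace]
  -- The sign is positive if the black square is east or north of the white one, negative if west or
  -- south.
  have hpos : ∀ f g : Face, IsClass 0 f → ¬ IsBlack g →
      (if f = g + axis 0 g then (1 : ℝ) else 0) - (if f = g - axis 0 g then 1 else 0) =
        (if f.1 = g.1 + 1 ∧ f.2 = g.2 ∨ f.1 = g.1 ∧ f.2 = g.2 + 1 then 1 else 0) -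
        (if f.1 = g.1 - 1 ∧ f.2 = g.2 ∨ f.1 = g.1 ∧ f.2 = g.2 - 1 then 1 else 0) := by
    rintro ⟨p, q⟩ ⟨x, y⟩ hf hg
    rw [hcl] at hf
    simp only at hf
    rcases axis_cases (k := 0) hg with ⟨e, -, h1, h2⟩ | ⟨e, -, h1, h2⟩ <;> rw [e] <;>
      simp only [Int.even_iff, sub_zero, Prod.mk_add_mk, Prod.mk_sub_mk, Prod.mk.injEq,
        add_zero] at * <;> congr 1 <;> congr 1 <;> rw [eq_iff_iff] <;> omega
  by_cases hb : IsBlack (leftFace z d)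
  · have hw : ¬ IsBlack (rightFace z d) := (isBlack_iff_of_adj hadj).mp hb
    have hn : ¬ ((rightFace z d).1 % 2 = 0 ∧ (rightFace z d).2 % 2 = 0) := fun h =>
      hw ((hcl _).mpr h).isBlack
    rw [if_pos hb, hδ _ _ hb hw, if_neg hn, add_zero]
    simp only [← hcl]
    by_cases h0 : IsClass 0 (leftFace z d)
    · rw [if_pos h0, if_pos h0, hpos _ _ h0 hw]
      cases d <;> simp [leftFace, rightFace] <;> split_ifs <;> first | omega | ring
    · rw [if_neg h0, if_neg h0, mul_zero, mul_zero]
  · have hw : IsBlack (rightFace z d) := (isBlack_iff_of_adj hadj.symm).mpr hb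
    have hn : ¬ ((leftFace z d).1 % 2 = 0 ∧ (leftFace z d).2 % 2 = 0) := fun h =>
      hb ((hcl _).mpr h).isBlack
    rw [if_neg hb, Sym2.eq_swap, hδ _ _ hw hb, if_neg hn, zero_add]
    simp only [← hcl]
    by_cases h0 : IsClass 0 (rightFace z d)
    · rw [if_pos h0, if_pos h0, hpos _ _ h0 hb]
      cases d <;> simp [leftFace, rightFace] <;> split_ifs <;> first | omega | ring
    · rw [if_neg h0, if_neg h0, mul_zero, mul_zero]

end DoubleDimer

/-! ### Summing the four leaps -/

theorem theorem1 (Ω : Finset DoubleDimer.Face) (hΩ : DoubleDimer.IsOddTemperley Ω)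
    (u₁ u₂ : DoubleDimer.Face)
    (hu₁ : DoubleDimer.IsBoundaryBlack Ω u₁) (hu₂ : DoubleDimer.IsBoundaryBlack Ω u₂)
    (ht₁ : (DoubleDimer.tilings (Ω.erase u₁)).Nonempty)
    (ht₂ : (DoubleDimer.tilings (Ω.erase u₂)).Nonempty)
    (z₀ : DoubleDimer.Vertex)
    (hz₁ : DoubleDimer.IsVertexOf (Ω.erase u₁) z₀)
    (hz₂ : DoubleDimer.IsVertexOf (Ω.erase u₂) z₀)
    (h₁ h₂ : Finset (Sym2 DoubleDimer.Face) → DoubleDimer.Vertex → ℝ)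
    (hh₁ : ∀ T ∈ DoubleDimer.tilings (Ω.erase u₁),
      DoubleDimer.IsHeightFunction (Ω.erase u₁) T z₀ (h₁ T))
    (hh₂ : ∀ T ∈ DoubleDimer.tilings (Ω.erase u₂),
      DoubleDimer.IsHeightFunction (Ω.erase u₂) T z₀ (h₂ T))
    (z : DoubleDimer.Vertex) (hz : DoubleDimer.IsInteriorVertex Ω z) :
    DoubleDimer.leapFrogLaplacian Ω
      (DoubleDimer.expectedHeight (Ω.erase u₁) (Ω.erase u₂) h₁ h₂) z = 0 := by
  open DoubleDimer in
  obtain ⟨hcard, G, hcurl, hδ⟩ := exists_curl_free_dominoCount hΩ hu₁ hu₂ ht₁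
  set δ : Sym2 Face → ℝ :=
    fun e => dominoCount (Ω.erase u₁) e - dominoCount (Ω.erase u₂) e with hδdef
  have hinc := edge_increments δ G hδ
  set q : Vertex → Dir → ℝ := fun z d =>
    (if IsBlack (leftFace z d) then -1 else 1) * δ s(leftFace z d, rightFace z d) with hq
  set N : ℝ := ((tilings (Ω.erase u₁)).card : ℝ)
  set H := expectedHeight (Ω.erase u₁) (Ω.erase u₂) h₁ h₂
  have hstep : ∀ z d, IsEdgeOf (Ω.erase u₁) z d → IsEdgeOf (Ω.erase u₂) z d →
      H (z + d.vec) - H z = q z d / N := fun z d he₁ he₂ =>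
    expectedHeight_step ht₁ ht₂ hh₁ hh₂ hcard he₁ he₂
  have hleap : ∀ d, leapValue Ω H z d - H z = (q z d + q (z + d.vec) d) / N := by
    intro d
    have hfirst := hstep z d (hz.isEdgeOf_erase u₁ d) (hz.isEdgeOf_erase u₂ d)
    unfold leapValue
    split_ifs with he
    · have hsecond := hstep (z + d.vec) d
        (hz.isEdgeOf_erase_next hΩ (hΩ.boundaryBlack_class hu₁) he)
        (hz.isEdgeOf_erase_next hΩ (hΩ.boundaryBlack_class hu₂) he)
      rw [add_div]
      linarith
    · have hl : ∀ u, leftFace (z + d.vec) d ∉ Ω.erase u := fun u h =>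
        he (Or.inl (Finset.mem_of_mem_erase h))
      -- Past the boundary no domino is possible, so the second increment is zero: exactly the
      -- convention for a leap leaving `Ω`.
      have h0 : q (z + d.vec) d = 0 := by
        simp only [hq, hδdef]
        rw [dominoCount_eq_zero (Sym2.mem_mk_left _ _) (hl u₁),
          dominoCount_eq_zero (Sym2.mem_mk_left _ _) (hl u₂), sub_self, mul_zero]
      rw [h0, add_zero]
      exact hfirst
  have hsum : ∑ d : Dir, (q z d + q (z + d.vec) d) = 0 := by
    have huniv : (Finset.univ : Finset Dir) = {.east, .north, .west, .south} := rfl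
    rw [huniv, Finset.sum_insert (by simp), Finset.sum_insert (by simp),
      Finset.sum_insert (by simp), Finset.sum_singleton]
    obtain ⟨x, y⟩ := z
    have qE : ∀ x y : ℤ, q (x, y) .east = -((if x % 2 = 0 ∧ y % 2 = 0 then G (x, y - 1) else 0) +
        (if x % 2 = 0 ∧ (y - 1) % 2 = 0 then G (x, y) else 0)) := fun x y =>
      (hinc (x, y) .east).trans (by simp [leftFace, rightFace])
    have qN : ∀ x y : ℤ, q (x, y) .north = (if (x - 1) % 2 = 0 ∧ y % 2 = 0 then G (x, y) else 0) +
        (if x % 2 = 0 ∧ y % 2 = 0 then G (x - 1, y) else 0) := fun x y =>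
      (hinc (x, y) .north).trans (by simp [leftFace, rightFace])
    have qW : ∀ x y : ℤ, q (x, y) .west =
        (if (x - 1) % 2 = 0 ∧ (y - 1) % 2 = 0 then G (x - 1, y) else 0) +
        (if (x - 1) % 2 = 0 ∧ y % 2 = 0 then G (x - 1, y - 1) else 0) := fun x y =>
      (hinc (x, y) .west).trans (by simp [leftFace, rightFace])
    have qS : ∀ x y : ℤ, q (x, y) .south =
        -((if x % 2 = 0 ∧ (y - 1) % 2 = 0 then G (x - 1, y - 1) else 0) +
        (if (x - 1) % 2 = 0 ∧ (y - 1) % 2 = 0 then G (x, y - 1) else 0)) := fun x y =>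
      (hinc (x, y) .south).trans (by simp [leftFace, rightFace])
    have vE : (x, y) + Dir.east.vec = (x + 1, y) := by simp [Dir.vec]
    have vN : (x, y) + Dir.north.vec = (x, y + 1) := by simp [Dir.vec]
    have vW : (x, y) + Dir.west.vec = (x - 1, y) := by simp [Dir.vec, sub_eq_add_neg]
    have vS : (x, y) + Dir.south.vec = (x, y - 1) := by simp [Dir.vec, sub_eq_add_neg]
    rw [vE, vN, vW, vS, qE, qE, qN, qN, qW, qW, qS, qS]
    -- For each parity of `z` exactly one of the four squares at `z` has class `1`. The four nonzero
    -- terms among the eight increments are the values of `G` around it, with the signs of the curl.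
    have hc : ∀ a b : ℤ, (a, b) ∈ facesAt (x, y) → a % 2 = 1 → b % 2 = 1 →
        G (a, b - 1) + G (a + 1, b) - G (a, b + 1) - G (a - 1, b) = 0 := fun a b hm ha hb =>
      hcurl a b (hz _ hm) ⟨by rw [Int.even_iff]; simp only; omega,
        by rw [Int.even_iff]; simp only; omega⟩
    have c1 := hc x y (by simp [facesAt])
    have c2 := hc (x - 1) y (by simp [facesAt])
    have c3 := hc (x - 1) (y - 1) (by simp [facesAt])
    have c4 := hc x (y - 1) (by simp [facesAt])
    simp only [sub_add_cancel] at c2 c3 c4 ⊢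
    rcases Int.emod_two_eq_zero_or_one x with hx | hx <;>
      rcases Int.emod_two_eq_zero_or_one y with hy | hy
    · have := c3 (by omega) (by omega)
      repeat' first | rw [if_pos (by omega)] | rw [if_neg (by omega)]
      linarith
    · have := c2 (by omega) (by omega)
      repeat' first | rw [if_pos (by omega)] | rw [if_neg (by omega)]
      linarith
    · have := c4 (by omega) (by omega)
      repeat' first | rw [if_pos (by omega)] | rw [if_neg (by omega)]
      linarith
    · have := c1 (by omega) (by omega)
      repeat' first | rw [if_pos (by omega)] | rw [if_neg (by omega)]
      linarith
  unfold leapFrogLaplacian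
  simp_rw [hleap]
  rw [← Finset.sum_div, hsum, zero_div, mul_zero]
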